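/- Let $\{\xi_k\}_{k\in\mathbb Z}$ and $\{\eta_k\}_{k\in\mathbb Z}$ be mutually independent, centred, (second-order) stationary complex random sequences with absolutely continuous spectral measures and spectral densities $f>0$, $g>0$ on $(-\pi,\pi]$, i.e. $f,g$ are integrable and $E\,\xi_n\overline{\xi_m}=\frac1{2\pi}\int_{-\pi}^{\pi}e^{i(n-m)\theta}f(\theta)\,d\theta$, and similarly for $\eta$ with $g$. Assume the minimality condition $$\int_{-\pi}^{\pi}\frac{d\theta}{f(\theta)+g(\theta)}<\infty .$$ Let $a=(a_0,a_1,\dots)$ be complex numbers with $\sum_j|a_j|<\infty$ and $\sum_j(j+1)|a_j|^2<\infty$, and put $A(e^{i\theta})=\sum_{j\ge0}a_je^{ij\theta}$ and $A\xi=\sum_{j\ge0}a_j\xi_j$ (convergent in mean square). Let $\mathbf B,\mathbf R,\mathbf Q$ be the operators given by the Toeplitz matrices whose $(k,j)$ entries, $k,j\ge0$, are $\frac1{2\pi}\int_{-\pi}^{\pi}e^{i(j-k)\theta}s(\theta)\,d\theta$ with $s=\frac1{f+g}$, $s=\frac f{f+g}$, $s=\frac{fg}{f+g}$ respectively. Let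 $\hat A\xi$ be the optimal linear estimate of $A\xi$ from the observations $\xi_k+\eta_k$, $k=-1,-2,\dots$, i.e. the orthogonal projection of $A\xi$ onto the closed linear span of these observations in mean square. The operator $\mathbf B$ need not be bounded on $\ell_2$ or boundedly invertible there, and $\mathbf B^{-1}$ is understood as follows: $c=\mathbf B^{-1}\mathbf Ra$ and $e=\langle\mathbf Ra,\mathbf B^{-1}\mathbf Ra\rangle$ mean that there are finitely supported sequences $x^{(n)}$, Cauchy in the norm $\langle\mathbf Bx,x\rangle^{1/2}$, such that $\mathbf Bx^{(n)}\to\mathbf Ra$ and $x^{(n)}\to c$ coordinatewise and $\langle\mathbf Ra,x^{(n)}\rangle\to e$. The sum $\sum_{j\ge0}c_je^{ij\theta}$ denotes the integrable function whose Fourier coefficients are $c_j$ for $j\ge0$ and $0$ for $j<0$. Then $\mathbf Ra\in\ell_2$; $c=\mathbf B^{-1}\mathbf Ra$ and $e=\langle\mathbf Ra,\mathbf B^{-1}\mathbf Ra\rangle$ exist and are unique; the function $C(\theta)=\sum_{j\ge0}(\mathbf B^{-1}\mathbf Ra)_je^{ij\theta}$ exists and is unique up to null sets; and: 1. $\hat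 A\xi=\int_{-\pi}^{\pi}h(\theta)\,\bigl(dZ^{\xi}(\theta)+dZ^{\eta}(\theta)\bigr)$, where $Z^\xi,Z^\eta$ are the random spectral measures of $\xi,\eta$ (that is, $\hat A\xi$ corresponds to $h$ under the isomorphism $e^{ik\theta}\leftrightarrow\xi_k+\eta_k$ of $L^2(f+g)$ onto the closed linear span of all $\xi_k+\eta_k$), and the spectral characteristic $h$, which is unique up to null sets and belongs to the closed span of $\{e^{ik\theta}:k\le-1\}$ in $L^2(f+g)$, is $$h(\theta)=\frac{A(e^{i\theta})f(\theta)-\sum_{j\ge0}(\mathbf B^{-1}\mathbf Ra)_je^{ij\theta}}{f(\theta)+g(\theta)}=A(e^{i\theta})-\frac{A(e^{i\theta})g(\theta)+\sum_{j\ge0}(\mathbf B^{-1}\mathbf Ra)_je^{ij\theta}}{f(\theta)+g(\theta)}.$$ 2. The mean square error is $$E|A\xi-\hat A\xi|^2=\frac1{2\pi}\int_{-\pi}^{\pi}\frac{|A(e^{i\theta})g(\theta)+C(\theta)|^2}{(f(\theta)+g(\theta))^2}f(\theta)\,d\theta+\frac1{2\pi}\int_{-\pi}^{\pi}\frac{|A(e^{i\theta})f(\theta)-C(\theta)|^2}{(f(\theta)+g(\theta))^2}g(\theta)\,d\theta=\langle\mathbf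 Ra,\mathbf B^{-1}\mathbf Ra\rangle+\langle\mathbf Qa,a\rangle .$$ 3. These notions agree with those of $\ell_2$ where the latter apply: if $\mathbf B$ is bounded on $\ell_2$ and $x\in\ell_2$ satisfies $\mathbf Bx=\mathbf Ra$, then $c=x$; if $f+g$ is essentially bounded, then $c\in\ell_2$; and if $c\in\ell_2$, then $e=\sum_k(\mathbf Ra)_k\overline{c_k}$ and the series $\sum_jc_je^{ij\theta}$ converges to $C$ in $L^2(-\pi,\pi)$. -/

import Mathlib

open MeasureTheory ProbabilityTheory Filter Topology
open scoped ComplexConjugate ENNReal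

noncomputable section

namespace Extrapolation

/-- Lebesgue measure on `(-π, π]`. -/
def circ : Measure ℝ := volume.restrict (Set.Ioc (-Real.pi) Real.pi)

/-- The exponential `e^{ikθ}`. -/
def ex (k : ℤ) (θ : ℝ) : ℂ := Complex.exp (Complex.I * (k : ℂ) * (θ : ℂ))

/-- The normalized integral `(1/2π) ∫_{-π}^{π} φ(θ) dθ`. -/
def mean (φ : ℝ → ℂ) : ℂ := ((1 / (2 * Real.pi) : ℝ) : ℂ) * ∫ θ, φ θ ∂circ

/-- The `k`-th Fourier coefficient `(1/2π) ∫ φ(θ) e^{-ikθ} dθ`. -/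
def fourierCoef (φ : ℝ → ℂ) (k : ℤ) : ℂ := mean fun θ => φ θ * ex (-k) θ

/-- The trigonometric polynomial `∑_k p_k e^{ikθ}`. -/
def trigPoly (p : ℤ →₀ ℂ) (θ : ℝ) : ℂ := p.sum fun k z => z * ex k θ

/-- `∫_{-π}^{π} |φ(θ)|² w(θ) dθ`, as an extended nonnegative number. -/
def sqDist (w : ℝ → ℝ) (φ : ℝ → ℂ) : ℝ≥0∞ :=
  ∫⁻ θ, ‖φ θ‖ₑ ^ 2 * ENNReal.ofReal (w θ) ∂circ

/-- `h` belongs to the closed linear span in `L²(w)` of the `e^{ikθ}`, `k ∈ S`. -/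
def MemClosedSpan (S : Set ℤ) (w : ℝ → ℝ) (h : ℝ → ℂ) : Prop :=
  AEStronglyMeasurable h circ ∧
    ∃ p : ℕ → (ℤ →₀ ℂ), (∀ n, ∀ k ∈ (p n).support, k ∈ S) ∧
      Tendsto (fun n => sqDist w fun θ => h θ - trigPoly (p n) θ) atTop (𝓝 0)

section Probability

variable {Ω : Type*} [MeasurableSpace Ω]

/-- `ξ` is a centred (second order) stationary random sequence whose spectral measure is
absolutely continuous with spectral density `f` (with respect to `dθ / 2π`). -/
structure IsStationary (P : Measure Ω) (ξ : ℤ → Ω → ℂ) (f : ℝ → ℝ) : Prop where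
  memLp : ∀ k, MemLp (ξ k) 2 P
  centred : ∀ k, ∫ ω, ξ k ω ∂P = 0
  integrable : Integrable f circ
  nonneg : ∀ᵐ θ ∂circ, 0 ≤ f θ
  cov : ∀ n m : ℤ, ∫ ω, ξ n ω * conj (ξ m ω) ∂P = mean fun θ => ex (n - m) θ * (f θ : ℂ)

/-- The `k`-th value of the sequence as an element of `L²(P)`. -/
def IsStationary.toL2 {P : Measure Ω} {ξ : ℤ → Ω → ℂ} {f : ℝ → ℝ}
    (h : IsStationary P ξ f) (k : ℤ) : Lp ℂ 2 P := (h.memLp k).toLp (ξ k)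

/-- `X = ∫ h(θ) dZ(θ)`, where `Z` is the random spectral measure of the stationary sequence `ζ`
with spectral density `w`: `X` corresponds to `h` under the isomorphism `e^{ikθ} ↔ ζ_k` between
`L²(w)` and the closed linear span of the `ζ_k`, extended by continuity from trigonometric
polynomials. -/
def IsSpectralIntegral {P : Measure Ω} (ζ : ℤ → Lp ℂ 2 P) (w : ℝ → ℝ) (h : ℝ → ℂ)
    (X : Lp ℂ 2 P) : Prop :=
  AEStronglyMeasurable h circ ∧
    ∃ p : ℕ → (ℤ →₀ ℂ),
      Tendsto (fun n => sqDist w fun θ => h θ - trigPoly (p n) θ) atTop (𝓝 0) ∧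
      Tendsto (fun n => (p n).sum fun k z => z • ζ k) atTop (𝓝 X)

/-- The closed linear manifold in `L²(P)` generated by the `ζ_k`, `k = -1, -2, …`. -/
def past {P : Measure Ω} (ζ : ℤ → Lp ℂ 2 P) : Submodule ℂ (Lp ℂ 2 P) :=
  (Submodule.span ℂ (ζ '' Set.Iio 0)).topologicalClosure

instance {P : Measure Ω} (ζ : ℤ → Lp ℂ 2 P) : CompleteSpace (past ζ) :=
  (Submodule.isClosed_topologicalClosure _).completeSpace_coe

/-- The optimal linear estimate of `X` from the `ζ_k`, `k = -1, -2, …`: the orthogonal projection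
of `X` onto `past ζ`. -/
def optimalEstimate {P : Measure Ω} (ζ : ℤ → Lp ℂ 2 P) (X : Lp ℂ 2 P) : Lp ℂ 2 P :=
  (past ζ).starProjection X

end Probability

/-- The symbol `A(e^{iθ}) = ∑_{j ≥ 0} a_j e^{ijθ}` of an absolutely summable sequence. -/
def symbolA (a : ℕ → ℂ) (θ : ℝ) : ℂ := ∑' j : ℕ, a j * ex j θ

/-- The Toeplitz matrix with entries `(1/2π) ∫ e^{i(j-k)θ} s(θ) dθ`, `k, j = 0, 1, 2, …`. -/
def toeplitz (s : ℝ → ℝ) (k j : ℕ) : ℂ := mean fun θ => ex ((j : ℤ) - k) θ * (s θ : ℂ)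

/-- The image `M x` of a sequence `x`, `(M x)_k = ∑_j M_{kj} x_j`. -/
def matVec (M : ℕ → ℕ → ℂ) (x : ℕ → ℂ) (k : ℕ) : ℂ := ∑' j, M k j * x j

/-- The inner product `⟨y, x⟩ = ∑_k y_k \bar{x_k}`. -/
def pairing (y x : ℕ → ℂ) : ℂ := ∑' k, y k * conj (x k)

/-- `c = M⁻¹ y` and `e = ⟨y, M⁻¹ y⟩` for a positive definite matrix `M` that need not be bounded
on `ℓ₂` or boundedly invertible there. The matrix operator, defined on finite sequences, is
extended by continuity to the completion in its energy norm `⟨M x, x⟩^{1/2}`: there are finite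
sequences `x⁽ⁿ⁾`, Cauchy in that norm, with `M x⁽ⁿ⁾ → y` and `x⁽ⁿ⁾ → c` coordinatewise and
`⟨y, x⁽ⁿ⁾⟩ → e`. -/
def IsInverse (M : ℕ → ℕ → ℂ) (y c : ℕ → ℂ) (e : ℂ) : Prop :=
  ∃ x : ℕ → (ℕ →₀ ℂ),
    (∀ ε > (0 : ℝ), ∃ N, ∀ m ≥ N, ∀ n ≥ N,
      ‖pairing (matVec M ⇑(x m - x n)) ⇑(x m - x n)‖ < ε) ∧
    (∀ k, Tendsto (fun n => matVec M ⇑(x n) k) atTop (𝓝 (y k))) ∧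
    (∀ j, Tendsto (fun n => x n j) atTop (𝓝 (c j))) ∧
    Tendsto (fun n => pairing y ⇑(x n)) atTop (𝓝 e)

/-- `C(θ) = ∑_{j ≥ 0} c_j e^{ijθ}`, as a Fourier series: `C` is the integrable function with
Fourier coefficients `c_j` for `j ≥ 0` and `0` for `j < 0`. -/
def IsFourierSum (c : ℕ → ℂ) (C : ℝ → ℂ) : Prop :=
  Integrable C circ ∧ (∀ j : ℕ, fourierCoef C j = c j) ∧ ∀ k : ℤ, k < 0 → fourierCoef C k = 0

end Extrapolation

end

/-!
Write `f + g = v²` and `u = 1/v`. The functions `v e^{ikθ}` and `u e^{ikθ}` are biorthogonal in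
`L²`, and `ξ_k + η_k ↔ v e^{ikθ}` is an isometry. Hence the orthogonal complement of the past
`v e^{ikθ}`, `k < 0`, is the closed span of the dual system `u e^{ikθ}`, `k ≥ 0`, whose Gram matrix
is `B`. The estimate from all observations has spectral characteristic `A f / (f + g)`, and the
estimate from the past is obtained from it by subtracting its projection `Cu` onto the dual span:
the normal equations of this projection are `B c = R a`, where `c_j` are the Fourier coefficients
of `C`. The error is that of the two-sided estimate, `⟨Qa, a⟩`, plus the squared norm of the
projection, `⟨Ra, B⁻¹Ra⟩`.
-/

noncomputable section

namespace Extrapolation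

lemma ex_zero (θ : ℝ) : ex 0 θ = 1 := by simp [ex]

lemma ex_add (j k : ℤ) (θ : ℝ) : ex (j + k) θ = ex j θ * ex k θ := by
  simp only [ex, ← Complex.exp_add]
  push_cast
  ring_nf

lemma conj_ex (k : ℤ) (θ : ℝ) : conj (ex k θ) = ex (-k) θ := by
  simp [ex, ← Complex.exp_conj]

lemma norm_ex (k : ℤ) (θ : ℝ) : ‖ex k θ‖ = 1 := by
  rw [ex, mul_comm Complex.I, mul_right_comm]
  exact_mod_cast Complex.norm_exp_ofReal_mul_I (k * θ)

lemma continuous_ex (k : ℤ) : Continuous (ex k) := by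
  unfold ex
  fun_prop

lemma ex_eq_fourier (k : ℤ) (θ : ℝ) : ex k θ = fourier k (θ : AddCircle (2 * Real.pi)) := by
  have : (Real.pi : ℂ) ≠ 0 := mod_cast Real.pi_ne_zero
  rw [fourier_coe_apply, ex]
  push_cast
  field_simp

/-- The normalized Lebesgue measure `dθ / 2π` on `(-π, π]`, for which `mean` is the integral and
the exponentials are orthonormal. -/
def circProb : Measure ℝ := ENNReal.ofReal (1 / (2 * Real.pi)) • circ

lemma ofReal_inv_two_pi_ne_zero : ENNReal.ofReal (1 / (2 * Real.pi)) ≠ 0 := by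
  simpa using Real.pi_pos

lemma ae_circProb : ae circProb = ae circ :=
  Measure.ae_ennreal_smul_measure_eq ofReal_inv_two_pi_ne_zero circ

instance : IsProbabilityMeasure circProb where
  measure_univ := by
    rw [circProb, circ, Measure.smul_apply, Measure.restrict_apply_univ, Real.volume_Ioc,
      smul_eq_mul, ← ENNReal.ofReal_mul (by positivity), ENNReal.ofReal_eq_one]
    field_simp
    ring

lemma integrable_circProb {E : Type*} [NormedAddCommGroup E] {φ : ℝ → E} :
    Integrable φ circProb ↔ Integrable φ circ :=
  integrable_smul_measure ofReal_inv_two_pi_ne_zero ENNReal.ofReal_ne_top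

lemma aestronglyMeasurable_circProb {φ : ℝ → ℂ} :
    AEStronglyMeasurable φ circProb ↔ AEStronglyMeasurable φ circ :=
  ⟨fun h => h.mono_ac (Measure.ae_le_iff_absolutelyContinuous.1 ae_circProb.ge),
    fun h => h.mono_ac (Measure.ae_le_iff_absolutelyContinuous.1 ae_circProb.le)⟩

lemma integral_circProb {E : Type*} [NormedAddCommGroup E] [NormedSpace ℝ E] (φ : ℝ → E) :
    ∫ θ, φ θ ∂circProb = (1 / (2 * Real.pi)) • ∫ θ, φ θ ∂circ := by
  rw [circProb, integral_smul_measure, ENNReal.toReal_ofReal (by positivity)]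

lemma mean_eq_integral (φ : ℝ → ℂ) : mean φ = ∫ θ, φ θ ∂circProb := by
  rw [integral_circProb, mean, Complex.real_smul]

lemma fourierCoef_eq_integral (φ : ℝ → ℂ) (k : ℤ) :
    fourierCoef φ k = ∫ θ, φ θ * ex (-k) θ ∂circProb :=
  mean_eq_integral _

lemma fourierCoef_congr {φ ψ : ℝ → ℂ} (h : φ =ᵐ[circProb] ψ) (k : ℤ) :
    fourierCoef φ k = fourierCoef ψ k := by
  simp only [fourierCoef_eq_integral]
  exact integral_congr_ae (h.mul (EventuallyEq.refl _ _))

lemma fourierCoef_conj (φ : ℝ → ℂ) (k : ℤ) :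
    fourierCoef (fun θ => conj (φ θ)) k = conj (fourierCoef φ (-k)) := by
  simp only [fourierCoef_eq_integral, ← integral_conj, map_mul, conj_ex, neg_neg]

lemma memLp_ex (k : ℤ) : MemLp (ex k) ∞ circProb :=
  memLp_top_of_bound (continuous_ex k).aestronglyMeasurable 1
    (.of_forall fun θ => (norm_ex k θ).le)

lemma integrable_mul_ex {φ : ℝ → ℂ} (hφ : Integrable φ circProb) (k : ℤ) :
    Integrable (fun θ => φ θ * ex k θ) circProb :=
  hφ.mul_bdd (c := 1) (continuous_ex k).aestronglyMeasurable (.of_forall fun θ => (norm_ex k θ).le)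

lemma fourierCoef_sub {φ ψ : ℝ → ℂ} (hφ : Integrable φ circProb) (hψ : Integrable ψ circProb)
    (k : ℤ) : fourierCoef (fun θ => φ θ - ψ θ) k = fourierCoef φ k - fourierCoef ψ k := by
  simp only [fourierCoef_eq_integral, sub_mul]
  exact integral_sub (integrable_mul_ex hφ _) (integrable_mul_ex hψ _)

lemma mean_ex (k : ℤ) : mean (ex k) = if k = 0 then 1 else 0 := by
  split_ifs with h
  · simp [h, mean_eq_integral, ex_zero]
  · have hk : Complex.I * (k : ℂ) ≠ 0 := mul_ne_zero Complex.I_ne_zero (mod_cast h)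
    have hint : ∫ θ, ex k θ ∂circ = ∫ θ in (-Real.pi)..Real.pi, ex k θ :=
      (intervalIntegral.integral_of_le (by linarith [Real.pi_pos])).symm
    have hper : Complex.exp (Complex.I * k * Real.pi)
        = Complex.exp (Complex.I * k * ((-Real.pi : ℝ) : ℂ)) := by
      rw [Complex.exp_eq_exp_iff_exists_int]
      exact ⟨k, by push_cast; ring⟩
    rw [mean, hint]
    simp only [ex, integral_exp_mul_complex hk, hper, sub_self, zero_div, mul_zero]

lemma fourierCoef_const (c : ℂ) (k : ℤ) :
    fourierCoef (fun _ => c) k = if k = 0 then c else 0 := by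
  rw [fourierCoef_eq_integral, integral_const_mul, ← mean_eq_integral, mean_ex]
  simp

/-! ### Uniqueness of Fourier coefficients of integrable functions -/

lemma integrable_mul_continuousMap {φ : ℝ → ℂ} (hφ : Integrable φ circProb)
    (g : C(AddCircle (2 * Real.pi), ℂ)) :
    Integrable (fun θ : ℝ => φ θ * g (θ : AddCircle (2 * Real.pi))) circProb :=
  have : Fact (0 < 2 * Real.pi) := ⟨Real.two_pi_pos⟩
  hφ.mul_bdd (c := ‖g‖)
    (g.continuous.comp (AddCircle.continuous_mk' _)).aestronglyMeasurable
    (.of_forall fun _ => g.norm_coe_le_norm _)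

lemma integral_mul_continuousMap_eq_zero {φ : ℝ → ℂ} (hφ : Integrable φ circProb)
    (h : ∀ k, fourierCoef φ k = 0) (g : C(AddCircle (2 * Real.pi), ℂ)) :
    ∫ θ, φ θ * g (θ : AddCircle (2 * Real.pi)) ∂circProb = 0 := by
  have : Fact (0 < 2 * Real.pi) := ⟨Real.two_pi_pos⟩
  let Λ : C(AddCircle (2 * Real.pi), ℂ) →L[ℂ] ℂ := LinearMap.mkContinuous
    { toFun := fun g => ∫ θ, φ θ * g (θ : AddCircle (2 * Real.pi)) ∂circProb
      map_add' := fun g g' => by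
        simp only [ContinuousMap.add_apply, mul_add]
        exact integral_add (integrable_mul_continuousMap hφ g) (integrable_mul_continuousMap hφ g')
      map_smul' := fun z g => by
        simp only [ContinuousMap.smul_apply, mul_smul_comm, integral_smul, RingHom.id_apply] }
    (∫ θ, ‖φ θ‖ ∂circProb) fun g => by
      rw [← integral_mul_const]
      refine norm_integral_le_of_norm_le (hφ.norm.mul_const _) (.of_forall fun θ => ?_)
      rw [norm_mul]
      gcongr
      exact g.norm_coe_le_norm _
  have hspan : Submodule.span ℂ (Set.range (@fourier (2 * Real.pi)))
      ≤ LinearMap.ker Λ.toLinearMap := by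
    rw [Submodule.span_le]
    rintro _ ⟨k, rfl⟩
    have hk := h (-k)
    simp only [fourierCoef_eq_integral, neg_neg, ex_eq_fourier] at hk
    exact hk
  have hker := Submodule.topologicalClosure_minimal _ hspan Λ.isClosed_ker
  rw [span_fourier_closure_eq_top] at hker
  exact hker (Submodule.mem_top (x := g))

lemma integral_smul_eq_zero_of_tsupport_subset {φ : ℝ → ℂ} (hφ : Integrable φ circProb)
    (h : ∀ k, fourierCoef φ k = 0) {g : ℝ → ℝ} (hg : Continuous g)
    (hsupp : tsupport g ⊆ Set.Ioo (-Real.pi) Real.pi) : ∫ θ, g θ • φ θ = 0 := by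
  have : Fact (0 < 2 * Real.pi) := ⟨Real.two_pi_pos⟩
  have hzero : ∀ x ∉ Set.Ioo (-Real.pi) Real.pi, g x = 0 := fun x hx =>
    image_eq_zero_of_notMem_tsupport fun hx' => hx (hsupp hx')
  have hcont : Continuous (AddCircle.liftIoc (2 * Real.pi) (-Real.pi) fun x => (g x : ℂ)) := by
    refine AddCircle.liftIoc_continuous ?_ (Complex.continuous_ofReal.comp hg).continuousOn
    rw [hzero _ (by simp), hzero (-Real.pi + 2 * Real.pi) fun hx => by linarith [hx.2]]
  have hint := integral_mul_continuousMap_eq_zero hφ h ⟨_, hcont⟩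
  rw [integral_circProb, smul_eq_zero_iff_right (by positivity)] at hint
  rw [← setIntegral_eq_integral_of_forall_compl_eq_zero (s := Set.Ioc (-Real.pi) Real.pi)
    fun x hx => by rw [hzero x fun hx' => hx (Set.Ioo_subset_Ioc_self hx'), zero_smul], ← hint]
  refine setIntegral_congr_fun measurableSet_Ioc fun x hx => ?_
  have hx' : x ∈ Set.Ioc (-Real.pi) (-Real.pi + 2 * Real.pi) := ⟨hx.1, by linarith [hx.2]⟩
  simp only [ContinuousMap.coe_mk, AddCircle.liftIoc_coe_apply hx', mul_comm, Complex.real_smul]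

lemma ae_eq_zero_of_fourierCoef_eq_zero {φ : ℝ → ℂ} (hφ : Integrable φ circProb)
    (h : ∀ k, fourierCoef φ k = 0) : φ =ᵐ[circProb] 0 := by
  have hloc : LocallyIntegrableOn φ (Set.Ioo (-Real.pi) Real.pi) volume :=
    IntegrableOn.locallyIntegrableOn
      (IntegrableOn.mono_set (integrable_circProb.1 hφ) Set.Ioo_subset_Ioc_self)
  rw [EventuallyEq, ae_circProb, circ, ← restrict_Ioo_eq_restrict_Ioc,
    ae_restrict_iff' measurableSet_Ioo]
  exact isOpen_Ioo.ae_eq_zero_of_integral_contDiff_smul_eq_zero hloc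
    fun g hg _ hsupp => integral_smul_eq_zero_of_tsupport_subset hφ h hg.continuous hsupp

lemma ae_eq_of_fourierCoef_eq {φ ψ : ℝ → ℂ} (hφ : Integrable φ circProb)
    (hψ : Integrable ψ circProb) (h : ∀ k, fourierCoef φ k = fourierCoef ψ k) :
    φ =ᵐ[circProb] ψ := by
  have := ae_eq_zero_of_fourierCoef_eq_zero (hφ.sub hψ) fun k => by
    rw [← sub_eq_zero.2 (h k), ← fourierCoef_sub hφ hψ]
    rfl
  filter_upwards [this] with θ hθ using sub_eq_zero.1 hθ

lemma ae_eq_mean_of_fourierCoef_eq_zero {φ : ℝ → ℂ} (hφ : Integrable φ circProb)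
    (h : ∀ k ≠ 0, fourierCoef φ k = 0) : ∀ᵐ θ ∂circProb, φ θ = mean φ := by
  refine ae_eq_of_fourierCoef_eq hφ (integrable_const _) fun k => ?_
  rw [fourierCoef_const]
  split_ifs with hk
  · simp [hk, fourierCoef, ex_zero]
  · exact h k hk

lemma IsFourierSum.ae_eq {c : ℕ → ℂ} {C C' : ℝ → ℂ} (h : IsFourierSum c C)
    (h' : IsFourierSum c C') : C' =ᵐ[circ] C := by
  rw [EventuallyEq, ← ae_circProb]
  refine ae_eq_of_fourierCoef_eq (integrable_circProb.2 h'.1) (integrable_circProb.2 h.1)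
    fun k => ?_
  rcases lt_or_ge k 0 with hk | hk
  · rw [h'.2.2 k hk, h.2.2 k hk]
  · lift k to ℕ using hk
    rw [h'.2.1, h.2.1]

/-! ### Closed spans -/

section ClosedSpan

variable {ι E F : Type*} [NormedAddCommGroup E] [InnerProductSpace ℂ E]
  [NormedAddCommGroup F] [InnerProductSpace ℂ F] {x : ι → E} {S : Set ι}

/-- The closed linear span of the vectors `x i`, `i ∈ S`. For `S` the negative integers this is
`past x`. -/
def closedSpan (x : ι → E) (S : Set ι) : Submodule ℂ E :=
  (Submodule.span ℂ (x '' S)).topologicalClosure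

lemma isClosed_closedSpan (x : ι → E) (S : Set ι) : IsClosed (closedSpan x S : Set E) :=
  Submodule.isClosed_topologicalClosure _

instance [CompleteSpace E] (x : ι → E) (S : Set ι) : CompleteSpace (closedSpan x S) :=
  (isClosed_closedSpan x S).completeSpace_coe

lemma mem_closedSpan (x : ι → E) {i : ι} (hi : i ∈ S) : x i ∈ closedSpan x S :=
  Submodule.le_topologicalClosure _ (Submodule.subset_span ⟨i, hi, rfl⟩)

lemma closedSpan_le {K : Submodule ℂ E} (hK : IsClosed (K : Set E)) (h : ∀ i ∈ S, x i ∈ K) :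
    closedSpan x S ≤ K := by
  refine Submodule.topologicalClosure_minimal _ (Submodule.span_le.2 ?_) hK
  rintro _ ⟨i, hi, rfl⟩
  exact h i hi

lemma closedSpan_mono {S T : Set ι} (h : S ⊆ T) : closedSpan x S ≤ closedSpan x T :=
  closedSpan_le (isClosed_closedSpan x T) fun _ hi => mem_closedSpan x (h hi)

lemma map_mem_of_mem_closedSpan (T : E →L[ℂ] F) {K : Submodule ℂ F} (hK : IsClosed (K : Set F))
    (h : ∀ i ∈ S, T (x i) ∈ K) {z : E} (hz : z ∈ closedSpan x S) : T z ∈ K :=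
  closedSpan_le (K := K.comap T.toLinearMap) (hK.preimage T.continuous) h hz

lemma mem_closedSpan_orthogonal {z : E} :
    z ∈ (closedSpan x S)ᗮ ↔ ∀ i ∈ S, inner ℂ (x i) z = 0 := by
  refine ⟨fun h i hi => h _ (mem_closedSpan x hi), fun h => ?_⟩
  have : closedSpan x S ≤ (ℂ ∙ z)ᗮ := closedSpan_le (Submodule.isClosed_orthogonal _)
    fun i hi => Submodule.mem_orthogonal_singleton_iff_inner_left.2 (h i hi)
  exact fun y hy => Submodule.mem_orthogonal_singleton_iff_inner_left.1 (this hy)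

lemma inner_eq_zero_of_mem_closedSpan {z y : E} (hy : y ∈ closedSpan x S)
    (h : ∀ i ∈ S, inner ℂ (x i) z = 0) : inner ℂ z y = 0 :=
  Submodule.inner_left_of_mem_orthogonal hy (mem_closedSpan_orthogonal.2 h)

end ClosedSpan

/-! ### The space `L²` of the circle -/

/-- The Hilbert space `L²((-π, π], dθ / 2π)`. -/
abbrev CircleL2 : Type := Lp ℂ 2 circProb

lemma inner_toLp_left {φ : ℝ → ℂ} (hφ : MemLp φ 2 circProb) (z : CircleL2) :
    inner ℂ (hφ.toLp φ) z = mean fun θ => z θ * conj (φ θ) := by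
  rw [L2.inner_def, mean_eq_integral]
  refine integral_congr_ae ?_
  filter_upwards [hφ.coeFn_toLp] with θ hθ
  rw [hθ, RCLike.inner_apply]

/-- Multiplication by an essentially bounded function, as an operator of `L²`. -/
def mulL {m : ℝ → ℂ} (hm : MemLp m ∞ circProb) : CircleL2 →L[ℂ] CircleL2 :=
  (ContinuousLinearMap.mul ℂ ℂ).holderL circProb ∞ 2 2 (hm.toLp m)

lemma coeFn_mulL {m : ℝ → ℂ} (hm : MemLp m ∞ circProb) (z : CircleL2) :
    mulL hm z =ᵐ[circProb] fun θ => m θ * z θ := by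
  filter_upwards [(ContinuousLinearMap.mul ℂ ℂ).coeFn_holder (r := 2) (hm.toLp m) z,
    hm.coeFn_toLp] with θ hmul hθ
  exact hmul.trans (by rw [hθ, ContinuousLinearMap.mul_apply'])

lemma integrable_mul_coeFn (x y : CircleL2) : Integrable (fun θ => x θ * y θ) circProb :=
  (Lp.memLp x).integrable_mul (Lp.memLp y)

lemma fourierCoef_mul_eq_inner (x y : CircleL2) (k : ℤ) :
    fourierCoef (fun θ => x θ * y θ) k = inner ℂ (star (mulL (memLp_ex (-k)) y)) x := by
  rw [fourierCoef_eq_integral, L2.inner_def]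
  refine integral_congr_ae ?_
  filter_upwards [coeFn_mulL (memLp_ex (-k)) y, Lp.coeFn_star (mulL (memLp_ex (-k)) y)]
    with θ hmul hstar
  rw [hstar, Pi.star_apply, hmul, RCLike.inner_apply, RCLike.star_def, Complex.conj_conj]
  ring

/-! ### Weighted exponentials -/

/-- The exponential `e^{ikθ}` of `L²(v²)`, carried over to the unweighted space by the isometry
`h ↦ h v`. -/
def wex (v : Lp ℝ 2 circProb) (k : ℤ) : CircleL2 :=
  ((Lp.memLp v).ofReal.mul (p := ∞) (memLp_ex k)).toLp fun θ => ex k θ * (v θ : ℂ)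

lemma coeFn_wex (v : Lp ℝ 2 circProb) (k : ℤ) :
    wex v k =ᵐ[circProb] fun θ => ex k θ * (v θ : ℂ) :=
  MemLp.coeFn_toLp _

lemma integrable_mul_weight (v : Lp ℝ 2 circProb) (z : CircleL2) :
    Integrable (fun θ => z θ * (v θ : ℂ)) circProb :=
  (Lp.memLp z).integrable_mul (Lp.memLp v).ofReal

lemma inner_wex (v : Lp ℝ 2 circProb) (k : ℤ) (z : CircleL2) :
    inner ℂ (wex v k) z = fourierCoef (fun θ => z θ * v θ) k := by
  rw [wex, inner_toLp_left, fourierCoef]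
  simp only [map_mul, conj_ex, Complex.conj_ofReal, mul_assoc, mul_comm (ex (-k) _)]

lemma inner_wex_wex (v u : Lp ℝ 2 circProb) (j k : ℤ) :
    inner ℂ (wex u j) (wex v k) = mean fun θ => ex (k - j) θ * (v θ * u θ : ℝ) := by
  rw [inner_wex, fourierCoef_eq_integral, mean_eq_integral]
  refine integral_congr_ae ?_
  filter_upwards [coeFn_wex v k] with θ hθ
  rw [hθ, sub_eq_add_neg, ex_add]
  push_cast
  ring

lemma mulL_ex_wex (v : Lp ℝ 2 circProb) (j k : ℤ) :
    mulL (memLp_ex j) (wex v k) = wex v (j + k) := by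
  refine Lp.ext ?_
  filter_upwards [coeFn_mulL (memLp_ex j) (wex v k), coeFn_wex v k, coeFn_wex v (j + k)]
    with θ hmul hk hjk
  rw [hmul, hk, hjk, ex_add, mul_assoc]

lemma mulL_ex_mem_closedSpan {v : Lp ℝ 2 circProb} {S T : Set ℤ} {j : ℤ}
    (h : ∀ k ∈ S, j + k ∈ T) {z : CircleL2} (hz : z ∈ closedSpan (wex v) S) :
    mulL (memLp_ex j) z ∈ closedSpan (wex v) T :=
  map_mem_of_mem_closedSpan _ (isClosed_closedSpan _ _)
    (fun k hk => by rw [mulL_ex_wex]; exact mem_closedSpan _ (h k hk)) hz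

lemma closedSpan_wex_univ {v : Lp ℝ 2 circProb} (hv : ∀ᵐ θ ∂circProb, v θ ≠ 0) :
    closedSpan (wex v) Set.univ = ⊤ := by
  rw [← Submodule.orthogonal_eq_bot_iff, Submodule.eq_bot_iff]
  intro z hz
  have hzero := ae_eq_zero_of_fourierCoef_eq_zero (integrable_mul_weight v z) fun k => by
    rw [← inner_wex, mem_closedSpan_orthogonal.1 hz k (Set.mem_univ k)]
  refine Lp.ext ?_
  filter_upwards [hzero, hv, Lp.coeFn_zero ℂ 2 circProb] with θ hθ hvθ h0
  rw [h0]
  exact (mul_eq_zero.1 hθ).resolve_right (Complex.ofReal_ne_zero.2 hvθ)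

lemma fourierCoef_mul_eq_zero_of_mem_closedSpan {v : Lp ℝ 2 circProb} {S : Set ℤ} {k : ℤ}
    {x y : CircleL2} (hx : x ∈ closedSpan (wex v) S)
    (hy : ∀ i ∈ S, inner ℂ (wex v (k - i)) y = 0) : fourierCoef (fun θ => x θ * y θ) k = 0 := by
  rw [fourierCoef_mul_eq_inner]
  refine inner_eq_zero_of_mem_closedSpan hx fun i hi => ?_
  suffices inner ℂ (wex v i) (star (mulL (memLp_ex (-k)) y)) = conj (inner ℂ (wex v (k - i)) y) by
    rw [this, hy i hi, map_zero]
  rw [inner_wex, inner_wex, fourierCoef_eq_integral, fourierCoef_eq_integral, ← integral_conj]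
  refine integral_congr_ae ?_
  filter_upwards [coeFn_mulL (memLp_ex (-k)) y, Lp.coeFn_star (mulL (memLp_ex (-k)) y)]
    with θ hmul hstar
  rw [hstar, Pi.star_apply, hmul, RCLike.star_def]
  simp only [map_mul, conj_ex, Complex.conj_ofReal, neg_neg, sub_eq_add_neg, ex_add]
  ring

/-! ### Reciprocal weights -/

/-- The weights `v` and `u` are reciprocal, so that `v²` and `v⁻²` are both integrable. -/
def IsReciprocal (v u : Lp ℝ 2 circProb) : Prop :=
  ∀ᵐ θ ∂circProb, v θ * u θ = 1

lemma IsReciprocal.symm {v u : Lp ℝ 2 circProb} (h : IsReciprocal v u) : IsReciprocal u v := by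
  filter_upwards [h] with θ hθ
  rw [mul_comm, hθ]

lemma IsReciprocal.inner_wex_wex {v u : Lp ℝ 2 circProb} (h : IsReciprocal v u) (j k : ℤ) :
    inner ℂ (wex u j) (wex v k) = if k = j then 1 else 0 := by
  rw [Extrapolation.inner_wex_wex, ← if_congr (sub_eq_zero (a := k) (b := j)) rfl rfl, ← mean_ex,
    mean_eq_integral, mean_eq_integral]
  refine integral_congr_ae ?_
  filter_upwards [h] with θ hθ
  rw [hθ, Complex.ofReal_one, mul_one]

/-- The weight `1`, for which the spans of `wex` are those of the exponentials themselves. -/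
def oneWeight : Lp ℝ 2 circProb := Lp.const 2 circProb 1

lemma coeFn_oneWeight : ∀ᵐ θ ∂circProb, oneWeight θ = 1 := Lp.coeFn_const 2 circProb 1

lemma isReciprocal_oneWeight : IsReciprocal oneWeight oneWeight := by
  filter_upwards [coeFn_oneWeight] with θ hθ
  rw [hθ, one_mul]

lemma inner_wex_oneWeight (k : ℤ) (z : CircleL2) :
    inner ℂ (wex oneWeight k) z = fourierCoef z k := by
  rw [inner_wex]
  refine fourierCoef_congr ?_ k
  filter_upwards [coeFn_oneWeight] with θ hθ
  rw [hθ, Complex.ofReal_one, mul_one]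

/-! ### Density of the analytic exponentials -/

/-- The Hardy space `H²`. -/
abbrev hardySpace : Submodule ℂ CircleL2 := closedSpan (wex oneWeight) (Set.Ici 0)

lemma mem_hardySpace {z : CircleL2} (hz : ∀ k < 0, fourierCoef z k = 0) :
    z ∈ hardySpace := by
  have hne : ∀ᵐ θ ∂circProb, oneWeight θ ≠ 0 := coeFn_oneWeight.mono fun θ hθ => by simp [hθ]
  have horth : z - hardySpace.starProjection z ∈ (closedSpan (wex oneWeight) Set.univ)ᗮ := by
    refine mem_closedSpan_orthogonal.2 fun k _ => ?_
    rcases lt_or_ge k 0 with hk | hk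
    · rw [inner_sub_right, inner_wex_oneWeight, hz k hk, zero_sub, neg_eq_zero]
      refine inner_eq_zero_of_mem_closedSpan (hardySpace.starProjection_apply_mem z) fun j hj => ?_
      rw [isReciprocal_oneWeight.inner_wex_wex, if_neg (hk.trans_le hj).ne]
    · exact hardySpace.sub_starProjection_mem_orthogonal z _ (mem_closedSpan _ hk)
  rw [closedSpan_wex_univ hne, Submodule.top_orthogonal_eq_bot, Submodule.mem_bot] at horth
  rw [sub_eq_zero.1 horth]
  exact hardySpace.starProjection_apply_mem z

/-- The innovation of the exponential `1` in `L²(v²)`: its distance vector from the closed span of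
the exponentials of positive frequency. -/
def innovation (v : Lp ℝ 2 circProb) : CircleL2 :=
  wex v 0 - (closedSpan (wex v) (Set.Ioi 0)).starProjection (wex v 0)

section Innovation

variable {v u : Lp ℝ 2 circProb}

lemma innovation_mem_closedSpan (v : Lp ℝ 2 circProb) :
    innovation v ∈ closedSpan (wex v) (Set.Ici 0) :=
  sub_mem (mem_closedSpan _ Set.self_mem_Ici)
    (closedSpan_mono Set.Ioi_subset_Ici_self (Submodule.starProjection_apply_mem _ _))

lemma innovation_mem_orthogonal (v : Lp ℝ 2 circProb) :
    innovation v ∈ (closedSpan (wex v) (Set.Ioi 0))ᗮ :=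
  Submodule.sub_starProjection_mem_orthogonal _

lemma innovation_ne_zero (h : IsReciprocal v u) : innovation v ≠ 0 := by
  have hinner : inner ℂ (wex u 0) (innovation v) = 1 := by
    rw [innovation, inner_sub_right, h.inner_wex_wex, if_pos rfl,
      inner_eq_zero_of_mem_closedSpan (Submodule.starProjection_apply_mem _ _), sub_zero]
    intro k hk
    rw [h.symm.inner_wex_wex, if_neg (ne_of_lt hk)]
  intro hzero
  rw [hzero, inner_zero_right] at hinner
  exact zero_ne_one hinner

/-- Since `e^{ikθ} d`, `k > 0`, lies in the span to which the innovation `d` is orthogonal, the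
nonzero Fourier coefficients of `|d|²` vanish. -/
lemma norm_innovation_ae_eq_const (v : Lp ℝ 2 circProb) :
    ∃ r : ℝ, ∀ᵐ θ ∂circProb, ‖innovation v θ‖ = r := by
  set d := innovation v
  have hshift : ∀ k : ℤ, 0 < k → inner ℂ (mulL (memLp_ex k) d) d = 0 := fun k hk =>
    innovation_mem_orthogonal v _ (mulL_ex_mem_closedSpan
      (fun j (hj : 0 ≤ j) => add_pos_of_pos_of_nonneg hk hj) (innovation_mem_closedSpan v))
  have hpos : ∀ k : ℤ, 0 < k → fourierCoef (fun θ => d θ * conj (d θ)) k = 0 := fun k hk => by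
    rw [← hshift k hk, L2.inner_def, fourierCoef_eq_integral]
    refine integral_congr_ae ?_
    filter_upwards [coeFn_mulL (memLp_ex k) d] with θ hθ
    rw [hθ, RCLike.inner_apply, map_mul, conj_ex]
    ring
  have hint : Integrable (fun θ => d θ * conj (d θ)) circProb :=
    (Lp.memLp d).integrable_mul (Lp.memLp d).star
  have hconst := ae_eq_mean_of_fourierCoef_eq_zero hint fun k hk => by
    rcases lt_or_gt_of_ne hk with hk | hk
    · have hconj := fourierCoef_conj (fun θ => d θ * conj (d θ)) k
      simpa only [map_mul, Complex.conj_conj, mul_comm (conj _), hpos (-k) (by omega), map_zero]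
        using hconj
    · exact hpos k hk
  refine ⟨√‖mean fun θ => d θ * conj (d θ)‖, ?_⟩
  filter_upwards [hconst] with θ hθ
  rw [← hθ, norm_mul, RCLike.norm_conj, Real.sqrt_mul_self (norm_nonneg _)]

lemma exists_unimodular_mem_closedSpan (h : IsReciprocal v u) :
    ∃ x : CircleL2, (∀ᵐ θ ∂circProb, ‖x θ‖ = 1) ∧ x ∈ closedSpan (wex v) (Set.Ici 0) ∧
      x ∈ (closedSpan (wex v) (Set.Ioi 0))ᗮ := by
  obtain ⟨r, hr⟩ := norm_innovation_ae_eq_const v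
  have hr0 : r ≠ 0 := by
    rintro rfl
    refine innovation_ne_zero h (Lp.ext ?_)
    filter_upwards [hr, Lp.coeFn_zero ℂ 2 circProb] with θ hθ h0
    rw [h0, Pi.zero_apply, norm_eq_zero.1 hθ]
  refine ⟨(r⁻¹ : ℂ) • innovation v, ?_, Submodule.smul_mem _ _ (innovation_mem_closedSpan v),
    Submodule.smul_mem _ _ (innovation_mem_orthogonal v)⟩
  filter_upwards [hr, Lp.coeFn_smul (r⁻¹ : ℂ) (innovation v)] with θ hθ hsmul
  rw [hsmul, Pi.smul_apply, norm_smul, hθ, norm_inv, Complex.norm_real,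
    Real.norm_of_nonneg (hθ ▸ norm_nonneg _), inv_mul_cancel₀ hr0]

end Innovation

lemma memLp_top_of_norm_eq_one {x : CircleL2} (hx : ∀ᵐ θ ∂circProb, ‖x θ‖ = 1) :
    MemLp x ∞ circProb :=
  memLp_top_of_bound (Lp.aestronglyMeasurable x) 1 (hx.mono fun _ h => h.le)

section Reciprocal

variable {v u : Lp ℝ 2 circProb} {x y z : CircleL2}

lemma IsReciprocal.fourierCoef_mul_eq_zero (h : IsReciprocal v u)
    (hx : x ∈ closedSpan (wex v) (Set.Ici 0)) (hy : y ∈ closedSpan (wex u) (Set.Ici 0))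
    {k : ℤ} (hk : k < 0) : fourierCoef (fun θ => x θ * y θ) k = 0 := by
  refine fourierCoef_mul_eq_zero_of_mem_closedSpan hx fun i (hi : 0 ≤ i) => ?_
  refine inner_eq_zero_of_mem_closedSpan hy fun j (hj : 0 ≤ j) => ?_
  rw [h.inner_wex_wex, if_neg (by omega)]

lemma exists_mem_hardySpace_of_mem_orthogonal (hx : ∀ᵐ θ ∂circProb, ‖x θ‖ = 1)
    (horth : x ∈ (closedSpan (wex v) (Set.Ioi 0))ᗮ) :
    ∃ F ∈ hardySpace, F =ᵐ[circProb] fun θ => conj (x θ) * v θ := by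
  have hmem : MemLp (fun θ => conj (x θ) * (v θ : ℂ)) 2 circProb :=
    (Lp.memLp v).ofReal.mul (memLp_top_of_norm_eq_one hx).star
  refine ⟨hmem.toLp _, mem_hardySpace fun k hk => ?_, hmem.coeFn_toLp⟩
  have hcoef : fourierCoef (fun θ => x θ * v θ) (-k) = 0 := by
    rw [← inner_wex, mem_closedSpan_orthogonal.1 horth (-k) (Set.mem_Ioi.2 (by omega))]
  have hconj := fourierCoef_conj (fun θ => x θ * v θ) k
  rw [hcoef, map_zero] at hconj
  simpa only [fourierCoef_congr hmem.coeFn_toLp, map_mul, Complex.conj_ofReal] using hconj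

lemma exists_unimodular (h : IsReciprocal v u) :
    ∃ x : CircleL2, (∀ᵐ θ ∂circProb, ‖x θ‖ = 1) ∧ x ∈ closedSpan (wex v) (Set.Ici 0) ∧
      star x ∈ closedSpan (wex u) (Set.Ici 0) := by
  obtain ⟨x, hx, hxmem, hxorth⟩ := exists_unimodular_mem_closedSpan h
  obtain ⟨y, hy, hymem, hyorth⟩ := exists_unimodular_mem_closedSpan h.symm
  obtain ⟨F, hF, hFx⟩ := exists_mem_hardySpace_of_mem_orthogonal hx hxorth
  obtain ⟨G, hG, hGy⟩ := exists_mem_hardySpace_of_mem_orthogonal hy hyorth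
  have hFG : (fun θ => F θ * G θ) =ᵐ[circProb] fun θ => conj (x θ * y θ) := by
    filter_upwards [hFx, hGy, h] with θ hFθ hGθ hvu
    rw [hFθ, hGθ, mul_mul_mul_comm, ← Complex.ofReal_mul, hvu, Complex.ofReal_one, mul_one, map_mul]
  have hxy := ae_eq_mean_of_fourierCoef_eq_zero (integrable_mul_coeFn x y) fun k hk => by
    rcases lt_or_gt_of_ne hk with hk | hk
    · exact h.fourierCoef_mul_eq_zero hxmem hymem hk
    · have hFGk : fourierCoef (fun θ => F θ * G θ) (-k) = 0 :=
        isReciprocal_oneWeight.fourierCoef_mul_eq_zero hF hG (by omega)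
      rwa [fourierCoef_congr hFG, fourierCoef_conj, neg_neg, map_eq_zero] at hFGk
  set κ := mean fun θ => x θ * y θ
  have hκ : κ ≠ 0 := by
    obtain ⟨θ, hθ, hxθ, hyθ⟩ := (hxy.and (hx.and hy)).exists
    rw [← norm_ne_zero_iff, ← hθ, norm_mul, hxθ, hyθ, one_mul]
    exact one_ne_zero
  have hstar : star x = κ⁻¹ • y := by
    refine Lp.ext ?_
    filter_upwards [hxy, hx, Lp.coeFn_star x, Lp.coeFn_smul κ⁻¹ y] with θ hθ hxθ hstar hsmul
    rw [hstar, hsmul, Pi.star_apply, Pi.smul_apply, smul_eq_mul, eq_inv_mul_iff_mul_eq₀ hκ, ← hθ,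
      mul_right_comm, RCLike.star_def, Complex.mul_conj, Complex.normSq_eq_norm_sq, hxθ]
    simp only [one_pow, Complex.ofReal_one, one_mul]
  exact ⟨x, hx, hxmem, hstar ▸ Submodule.smul_mem _ _ hymem⟩

lemma mulL_mem_closedSpan_of_mem_hardySpace {m : CircleL2} (hm : MemLp m ∞ circProb)
    (hmem : m ∈ closedSpan (wex v) (Set.Ici 0)) (hz : z ∈ hardySpace) :
    mulL hm z ∈ closedSpan (wex v) (Set.Ici 0) := by
  refine map_mem_of_mem_closedSpan _ (isClosed_closedSpan _ _) (fun j (hj : 0 ≤ j) => ?_) hz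
  have hcomm : mulL hm (wex oneWeight j) = mulL (memLp_ex j) m := by
    refine Lp.ext ?_
    filter_upwards [coeFn_mulL hm (wex oneWeight j), coeFn_mulL (memLp_ex j) m,
      coeFn_wex oneWeight j, coeFn_oneWeight] with θ hl hr hwex hone
    rw [hl, hr, hwex, hone, Complex.ofReal_one, mul_one, mul_comm]
  rw [hcomm]
  exact mulL_ex_mem_closedSpan (fun k hk => add_nonneg hj hk) hmem

/-- If `x` is unimodular and both `x` and `conj x` are analytic for the reciprocal weights, then
multiplication by `conj x` maps the orthogonal complement into the Hardy space, and
multiplication by `x` maps the Hardy space back into the weighted span. -/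
lemma orthogonal_Iio_le_closedSpan (h : IsReciprocal v u) :
    (closedSpan (wex u) (Set.Iio 0))ᗮ ≤ closedSpan (wex v) (Set.Ici 0) := by
  intro z hz
  obtain ⟨x, hx, hxmem, hstar⟩ := exists_unimodular h
  have hxtop := memLp_top_of_norm_eq_one hx
  have hzx : mulL hxtop.star z ∈ hardySpace := mem_hardySpace fun k hk => by
    rw [← fourierCoef_mul_eq_zero_of_mem_closedSpan hstar fun i (hi : 0 ≤ i) =>
      mem_closedSpan_orthogonal.1 hz (k - i) (Set.mem_Iio.2 (by omega))]
    refine fourierCoef_congr ?_ k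
    filter_upwards [coeFn_mulL hxtop.star z, Lp.coeFn_star x] with θ hmul hconj
    rw [hmul, hconj]
  have hxx : mulL hxtop (mulL hxtop.star z) = z := by
    refine Lp.ext ?_
    filter_upwards [coeFn_mulL hxtop (mulL hxtop.star z), coeFn_mulL hxtop.star z, hx]
      with θ hmul hmul' hxθ
    rw [hmul, hmul', ← mul_assoc, Pi.star_apply, RCLike.star_def, Complex.mul_conj,
      Complex.normSq_eq_norm_sq, hxθ, one_pow, Complex.ofReal_one, one_mul]
  rw [← hxx]
  exact mulL_mem_closedSpan_of_mem_hardySpace hxtop hxmem hzx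

lemma orthogonal_Ici_le_closedSpan (h : IsReciprocal v u) :
    (closedSpan (wex u) (Set.Ici 0))ᗮ ≤ closedSpan (wex v) (Set.Iio 0) := by
  have := Submodule.orthogonal_le (orthogonal_Iio_le_closedSpan h.symm)
  rwa [Submodule.orthogonal_orthogonal] at this

end Reciprocal

/-! ### Spectral integrals -/

section ClosedSpan

variable {ι E F : Type*} [NormedAddCommGroup E] [InnerProductSpace ℂ E]
  [NormedAddCommGroup F] [InnerProductSpace ℂ F] {x : ι → E} {S : Set ι}

lemma exists_tendsto_linearCombination {z : E} (hz : z ∈ closedSpan x S) :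
    ∃ p : ℕ → (ι →₀ ℂ), (∀ n, ∀ i ∈ (p n).support, i ∈ S) ∧
      Tendsto (fun n => Finsupp.linearCombination ℂ x (p n)) atTop (𝓝 z) := by
  obtain ⟨y, hy, hlim⟩ := mem_closure_iff_seq_limit.1 hz
  choose p hpS hp using fun n => (Finsupp.mem_span_image_iff_linearCombination ℂ).1 (hy n)
  exact ⟨p, fun n i hi => hpS n hi, by simpa only [hp] using hlim⟩

lemma linearCombination_mem_closedSpan (x : ι → E) {p : ι →₀ ℂ} (hp : ∀ i ∈ p.support, i ∈ S) :
    Finsupp.linearCombination ℂ x p ∈ closedSpan x S :=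
  Submodule.le_topologicalClosure _
    ((Finsupp.mem_span_image_iff_linearCombination ℂ).2 ⟨p, hp, rfl⟩)

lemma closedSpan_comp {κ : Type*} (x : ι → E) (e : κ → ι) :
    closedSpan (x ∘ e) Set.univ = closedSpan x (Set.range e) := by
  rw [closedSpan, closedSpan, Set.image_univ, Set.range_comp]

lemma inner_linearCombination (x : ι → E) (p q : ι →₀ ℂ) :
    inner ℂ (Finsupp.linearCombination ℂ x p) (Finsupp.linearCombination ℂ x q) =
      p.sum fun i s => q.sum fun j t => conj s * t * inner ℂ (x i) (x j) := by
  simp only [Finsupp.linearCombination_apply, Finsupp.sum, sum_inner]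
  refine Finset.sum_congr rfl fun i _ => ?_
  simp only [inner_sum, inner_smul_left, inner_smul_right, mul_assoc, mul_left_comm]

lemma exists_linearIsometry_of_inner_eq [CompleteSpace F] {y : ι → F}
    (hx : closedSpan x Set.univ = ⊤) (h : ∀ i j, inner ℂ (y i) (y j) = inner ℂ (x i) (x j)) :
    ∃ U : E →ₗᵢ[ℂ] F, ∀ i, U (x i) = y i := by
  let lx := Finsupp.linearCombination ℂ x
  let ly := Finsupp.linearCombination ℂ y
  have hnorm : ∀ p, ‖ly p‖ = ‖lx p‖ := fun p => by
    rw [@norm_eq_sqrt_re_inner ℂ, @norm_eq_sqrt_re_inner ℂ E, inner_linearCombination,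
      inner_linearCombination]
    simp only [h]
  have hdense : DenseRange lx := fun z => by
    obtain ⟨p, -, hp⟩ := exists_tendsto_linearCombination (hx ▸ Submodule.mem_top : z ∈ _)
    exact mem_closure_of_tendsto hp (.of_forall fun n => ⟨p n, rfl⟩)
  have heq : ∀ p, ly.extendOfNorm lx (lx p) = ly p := fun p =>
    LinearMap.extendOfNorm_eq hdense ⟨1, fun p => by rw [hnorm, one_mul]⟩ p
  have hiso : ∀ z, ‖ly.extendOfNorm lx z‖ = ‖z‖ := fun z =>
    hdense.induction_on z (isClosed_eq (by fun_prop) (by fun_prop)) fun p => by rw [heq, hnorm]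
  refine ⟨⟨(ly.extendOfNorm lx).toLinearMap, hiso⟩, fun i => ?_⟩
  simpa [lx, ly] using heq (Finsupp.single i 1)

end ClosedSpan

lemma coeFn_linearCombination_wex (v : Lp ℝ 2 circProb) (p : ℤ →₀ ℂ) :
    Finsupp.linearCombination ℂ (wex v) p =ᵐ[circProb] fun θ => trigPoly p θ * (v θ : ℂ) := by
  induction p using Finsupp.induction_linear with
  | zero =>
    rw [map_zero]
    filter_upwards [Lp.coeFn_zero ℂ 2 circProb] with θ hθ
    rw [hθ, trigPoly, Finsupp.sum_zero_index, zero_mul, Pi.zero_apply]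
  | add p q hp hq =>
    rw [map_add]
    filter_upwards [hp, hq, Lp.coeFn_add (Finsupp.linearCombination ℂ (wex v) p)
      (Finsupp.linearCombination ℂ (wex v) q)] with θ hpθ hqθ hadd
    rw [hadd, Pi.add_apply, hpθ, hqθ, ← add_mul, trigPoly, trigPoly, trigPoly,
      Finsupp.sum_add_index' (by simp) (by simp [add_mul])]
  | single k z =>
    rw [Finsupp.linearCombination_single]
    filter_upwards [coeFn_wex v k, Lp.coeFn_smul z (wex v k)] with θ hk hsmul
    simp [hsmul, hk, trigPoly, mul_assoc]

lemma exists_Lp_ae_eq_sqrt {w : ℝ → ℝ} (hw : Integrable w circProb)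
    (hpos : ∀ᵐ θ ∂circProb, 0 ≤ w θ) : ∃ v : Lp ℝ 2 circProb, v =ᵐ[circProb] fun θ => √(w θ) := by
  have hmem : MemLp (fun θ => √(w θ)) 2 circProb := by
    rw [memLp_two_iff_integrable_sq hw.1.aemeasurable.sqrt.aestronglyMeasurable]
    refine hw.congr ?_
    filter_upwards [hpos] with θ hθ
    rw [Real.sq_sqrt hθ]
  exact ⟨hmem.toLp _, hmem.coeFn_toLp⟩

lemma exists_isReciprocal {w : ℝ → ℝ} (hw : Integrable w circProb)
    (hinv : Integrable (fun θ => (w θ)⁻¹) circProb) (hpos : ∀ᵐ θ ∂circProb, 0 < w θ) :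
    ∃ v u, IsReciprocal v u ∧ ∀ᵐ θ ∂circProb, v θ ^ 2 = w θ := by
  obtain ⟨v, hv⟩ := exists_Lp_ae_eq_sqrt hw (hpos.mono fun _ => le_of_lt)
  obtain ⟨u, hu⟩ := exists_Lp_ae_eq_sqrt hinv (hpos.mono fun _ h => (inv_pos.2 h).le)
  refine ⟨v, u, ?_, ?_⟩
  · filter_upwards [hv, hu, hpos] with θ hvθ huθ hθ
    rw [hvθ, huθ, Real.sqrt_inv, mul_inv_cancel₀ (Real.sqrt_pos.2 hθ).ne']
  · filter_upwards [hv, hpos] with θ hvθ hθ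
    rw [hvθ, Real.sq_sqrt hθ.le]

lemma lintegral_circ (φ : ℝ → ℝ≥0∞) :
    ∫⁻ θ, φ θ ∂circ = ENNReal.ofReal (2 * Real.pi) * ∫⁻ θ, φ θ ∂circProb := by
  rw [circProb, lintegral_smul_measure, smul_eq_mul, ← mul_assoc,
    ← ENNReal.ofReal_mul (by positivity), mul_one_div_cancel (by positivity), ENNReal.ofReal_one,
    one_mul]

section Weighted

variable {w : ℝ → ℝ} {v : Lp ℝ 2 circProb}

lemma sqDist_eq_eLpNorm (hv : ∀ᵐ θ ∂circProb, v θ ^ 2 = w θ) (φ : ℝ → ℂ) :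
    sqDist w φ =
      ENNReal.ofReal (2 * Real.pi) * eLpNorm (fun θ => φ θ * (v θ : ℂ)) 2 circProb ^ 2 := by
  have hnorm := eLpNorm_nnreal_pow_eq_lintegral (μ := circProb)
    (f := fun θ => φ θ * (v θ : ℂ)) (p := 2) two_ne_zero
  simp only [NNReal.coe_ofNat, ENNReal.rpow_ofNat, ENNReal.coe_ofNat] at hnorm
  rw [hnorm, sqDist, lintegral_circ]
  congr 1
  refine lintegral_congr_ae ?_
  filter_upwards [hv] with θ hθ
  rw [← hθ, enorm_mul, mul_pow, ← sq_abs, ENNReal.ofReal_pow (abs_nonneg _), ← Real.norm_eq_abs,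
    ← Complex.norm_real, ofReal_norm]

lemma sqDist_sub_trigPoly (hv : ∀ᵐ θ ∂circProb, v θ ^ 2 = w θ) (h : ℝ → ℂ) (p : ℤ →₀ ℂ) :
    sqDist w (fun θ => h θ - trigPoly p θ) = ENNReal.ofReal (2 * Real.pi) *
      eLpNorm (fun θ => h θ * v θ - Finsupp.linearCombination ℂ (wex v) p θ) 2 circProb ^ 2 := by
  rw [sqDist_eq_eLpNorm hv]
  congr 2
  refine eLpNorm_congr_ae ?_
  filter_upwards [coeFn_linearCombination_wex v p] with θ hθ
  rw [hθ, sub_mul]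

lemma tendsto_sqDist_iff_of_ae_eq (hv : ∀ᵐ θ ∂circProb, v θ ^ 2 = w θ) {h : ℝ → ℂ} {z : CircleL2}
    (hz : z =ᵐ[circProb] fun θ => h θ * v θ) (p : ℕ → (ℤ →₀ ℂ)) :
    Tendsto (fun n => sqDist w fun θ => h θ - trigPoly (p n) θ) atTop (𝓝 0) ↔
      Tendsto (fun n => Finsupp.linearCombination ℂ (wex v) (p n)) atTop (𝓝 z) := by
  have heq : ∀ n, sqDist w (fun θ => h θ - trigPoly (p n) θ) = ENNReal.ofReal (2 * Real.pi) *
      ‖z - Finsupp.linearCombination ℂ (wex v) (p n)‖ₑ ^ 2 := fun n => by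
    rw [sqDist_sub_trigPoly hv, Lp.enorm_def]
    congr 2
    refine eLpNorm_congr_ae ?_
    filter_upwards [hz, Lp.coeFn_sub z (Finsupp.linearCombination ℂ (wex v) (p n))] with θ hθ hsub
    rw [hsub, Pi.sub_apply, hθ]
  simp only [heq]
  rw [← ENNReal.tendsto_toReal_zero_iff fun n => by finiteness,
    tendsto_iff_norm_sub_tendsto_zero (b := z)]
  simp only [ENNReal.toReal_mul, ENNReal.toReal_pow, toReal_enorm, norm_sub_rev z,
    ENNReal.toReal_ofReal Real.two_pi_pos.le]
  refine ⟨fun h => ?_, fun h => by simpa using (h.pow 2).const_mul (2 * Real.pi)⟩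
  simpa [inv_mul_cancel_left₀ Real.two_pi_pos.ne', - mul_inv_rev] using
    (h.const_mul (2 * Real.pi)⁻¹).sqrt

lemma exists_ae_eq_of_tendsto_sqDist (hv : ∀ᵐ θ ∂circProb, v θ ^ 2 = w θ) {h : ℝ → ℂ}
    (hh : AEStronglyMeasurable h circProb) {p : ℕ → (ℤ →₀ ℂ)}
    (hp : Tendsto (fun n => sqDist w fun θ => h θ - trigPoly (p n) θ) atTop (𝓝 0)) :
    ∃ z : CircleL2, z =ᵐ[circProb] fun θ => h θ * v θ := by
  obtain ⟨n, hn⟩ := (hp.eventually_lt_const ENNReal.zero_lt_top).exists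
  rw [sqDist_sub_trigPoly hv] at hn
  set q := Finsupp.linearCombination ℂ (wex v) (p n)
  have hmeas : AEStronglyMeasurable (fun θ => h θ * (v θ : ℂ)) circProb :=
    hh.mul (Lp.memLp v).ofReal.1
  have hsub : MemLp (fun θ => h θ * v θ - q θ) 2 circProb := by
    refine ⟨hmeas.sub (Lp.memLp q).1, ?_⟩
    by_contra htop
    rw [not_lt, top_le_iff] at htop
    rw [htop] at hn
    simp [Real.pi_pos] at hn
  have hmem : MemLp (fun θ => h θ * (v θ : ℂ)) 2 circProb :=
    (memLp_congr_ae (.of_forall fun θ => sub_add_cancel _ _)).1 (hsub.add (Lp.memLp q))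
  exact ⟨hmem.toLp _, hmem.coeFn_toLp⟩

lemma aestronglyMeasurable_of_mul_weight (hv : ∀ᵐ θ ∂circProb, v θ ≠ 0) {h : ℝ → ℂ} {z : CircleL2}
    (hz : z =ᵐ[circProb] fun θ => h θ * v θ) : AEStronglyMeasurable h circProb := by
  refine ((Lp.memLp z).1.mul (Lp.memLp v).ofReal.1.inv₀).congr ?_
  filter_upwards [hv, hz] with θ hvθ hzθ
  simp [hzθ, hvθ]

lemma memClosedSpan_of_mem_closedSpan (hv : ∀ᵐ θ ∂circProb, v θ ^ 2 = w θ) {S : Set ℤ} {h : ℝ → ℂ}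
    (hh : AEStronglyMeasurable h circProb) {z : CircleL2}
    (hz : z =ᵐ[circProb] fun θ => h θ * v θ) (hzS : z ∈ closedSpan (wex v) S) :
    MemClosedSpan S w h := by
  obtain ⟨p, hpS, hp⟩ := exists_tendsto_linearCombination hzS
  exact ⟨aestronglyMeasurable_circProb.1 hh, p, hpS, (tendsto_sqDist_iff_of_ae_eq hv hz p).2 hp⟩

end Weighted

section Isometry

variable {Ω : Type*} [MeasurableSpace Ω] {P : Measure Ω} {ζ : ℤ → Lp ℂ 2 P}
  {v u : Lp ℝ 2 circProb} {U : CircleL2 →ₗᵢ[ℂ] Lp ℂ 2 P}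

lemma isSpectralIntegral_iff (hU : ∀ k, U (wex v k) = ζ k) {w : ℝ → ℝ}
    (hv : ∀ᵐ θ ∂circProb, v θ ^ 2 = w θ) (hv0 : ∀ᵐ θ ∂circProb, v θ ≠ 0) {h : ℝ → ℂ}
    {z : CircleL2} :
    IsSpectralIntegral ζ w h (U z) ↔ z =ᵐ[circProb] fun θ => h θ * v θ := by
  have hsum : ∀ p : ℤ →₀ ℂ,
      (p.sum fun k t => t • ζ k) = U (Finsupp.linearCombination ℂ (wex v) p) := fun p => by
    simp only [Finsupp.linearCombination_apply, map_finsuppSum, map_smul, hU]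
  simp only [IsSpectralIntegral, ← aestronglyMeasurable_circProb, hsum]
  constructor
  · rintro ⟨hmeas, p, hp, hlim⟩
    obtain ⟨y, hy⟩ := exists_ae_eq_of_tendsto_sqDist hv hmeas hp
    have hUy := (U.continuous.tendsto y).comp ((tendsto_sqDist_iff_of_ae_eq hv hy p).1 hp)
    rwa [← U.injective (tendsto_nhds_unique hUy hlim)]
  · intro hz
    obtain ⟨p, -, hp⟩ := exists_tendsto_linearCombination
      (closedSpan_wex_univ hv0 ▸ Submodule.mem_top : z ∈ closedSpan (wex v) Set.univ)
    exact ⟨aestronglyMeasurable_of_mul_weight hv0 hz, p,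
      (tendsto_sqDist_iff_of_ae_eq hv hz p).2 hp, (U.continuous.tendsto z).comp hp⟩

/-! ### Prediction by duality -/

/-- The projection of `Y` onto the span of the `u e^{ikθ}`, `k ≥ 0`. When `u` is the reciprocal
of `v`, it is the error of the best approximation of `Y` by the `v e^{ikθ}`, `k < 0`. -/
def dualProj (u : Lp ℝ 2 circProb) (Y : CircleL2) : CircleL2 :=
  (closedSpan (wex u) (Set.Ici 0)).starProjection Y

lemma sub_dualProj_mem_closedSpan (h : IsReciprocal v u) (Y : CircleL2) :
    Y - dualProj u Y ∈ closedSpan (wex v) (Set.Iio 0) :=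
  orthogonal_Ici_le_closedSpan h (Submodule.sub_starProjection_mem_orthogonal Y)

lemma inner_wex_dualProj_of_neg (h : IsReciprocal v u) (Y : CircleL2) {k : ℤ} (hk : k < 0) :
    inner ℂ (wex v k) (dualProj u Y) = 0 :=
  inner_eq_zero_of_mem_closedSpan (Submodule.starProjection_apply_mem _ _) fun j (hj : 0 ≤ j) => by
    rw [h.inner_wex_wex, if_neg (hk.trans_le hj).ne]

lemma norm_sub_dualProj_sq (u : Lp ℝ 2 circProb) (Y : CircleL2) :
    ‖Y - dualProj u Y‖ ^ 2 = ‖Y‖ ^ 2 - ‖dualProj u Y‖ ^ 2 := by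
  rw [Submodule.norm_sq_eq_add_norm_sq_starProjection Y (closedSpan (wex u) (Set.Ici 0)),
    Submodule.starProjection_orthogonal_val, ← dualProj]
  ring

lemma optimalEstimate_eq (h : IsReciprocal v u) (hU : ∀ k, U (wex v k) = ζ k) {S : Lp ℂ 2 P}
    {Y : CircleL2} (hS : ∀ k, inner ℂ (ζ k) S = inner ℂ (wex v k) Y) :
    optimalEstimate ζ S = U (Y - dualProj u Y) := by
  have hmem : U (Y - dualProj u Y) ∈ past ζ :=
    map_mem_of_mem_closedSpan U.toContinuousLinearMap (isClosed_closedSpan ζ (Set.Iio 0))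
      (fun k hk => (hU k).symm ▸ mem_closedSpan ζ hk) (sub_dualProj_mem_closedSpan h Y)
  have horth : S - U (Y - dualProj u Y) ∈ (past ζ)ᗮ :=
    mem_closedSpan_orthogonal.2 fun k hk => by
      rw [inner_sub_right, hS, ← hU, U.inner_map_map, ← inner_sub_right, sub_sub_cancel,
        inner_wex_dualProj_of_neg h Y hk]
  exact Submodule.eq_starProjection_of_mem_orthogonal hmem horth

lemma norm_sub_optimalEstimate_sq (h : IsReciprocal v u) (hU : ∀ k, U (wex v k) = ζ k)
    {S : Lp ℂ 2 P} {Y : CircleL2} (hS : ∀ k, inner ℂ (ζ k) S = inner ℂ (wex v k) Y) :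
    ‖S - optimalEstimate ζ S‖ ^ 2 = ‖S‖ ^ 2 - ‖Y‖ ^ 2 + ‖dualProj u Y‖ ^ 2 := by
  have hpyth := Submodule.norm_sq_eq_add_norm_sq_starProjection S (past ζ)
  rw [Submodule.starProjection_orthogonal_val, ← optimalEstimate] at hpyth
  have hest : ‖optimalEstimate ζ S‖ ^ 2 = ‖Y‖ ^ 2 - ‖dualProj u Y‖ ^ 2 := by
    rw [optimalEstimate_eq h hU hS, U.norm_map, norm_sub_dualProj_sq]
  linarith

end Isometry

/-! ### Inverses in the energy norm -/

section Gram

variable {E : Type*} [NormedAddCommGroup E] [InnerProductSpace ℂ E]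

lemma hasSum_linearCombination (x : ℕ → E) (p : ℕ →₀ ℂ) :
    HasSum (fun j => p j • x j) (Finsupp.linearCombination ℂ x p) := by
  rw [Finsupp.linearCombination_apply]
  exact hasSum_sum_of_ne_finset_zero fun j hj => by
    rw [Finsupp.notMem_support_iff.1 hj, zero_smul]

lemma matVec_gram {x : ℕ → E} {a : ℕ → ℂ} {Z : E} (hZ : HasSum (fun j => a j • x j) Z) :
    matVec (fun k j => inner ℂ (x k) (x j)) a = fun k => inner ℂ (x k) Z := by
  ext k
  have hsum := hZ.mapL (innerSL ℂ (x k))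
  simp only [innerSL_apply_apply, inner_smul_right] at hsum
  rw [matVec, ← hsum.tsum_eq]
  simp only [mul_comm]

lemma pairing_inner {x : ℕ → E} {a : ℕ → ℂ} {Z : E} (hZ : HasSum (fun j => a j • x j) Z) (Y : E) :
    pairing (fun k => inner ℂ (x k) Y) a = inner ℂ Z Y := by
  have hsum := (hZ.mapL (innerSL ℂ Y)).star
  simp only [innerSL_apply_apply, inner_smul_right, star_mul', RCLike.star_def,
    inner_conj_symm] at hsum
  rw [pairing, ← hsum.tsum_eq]
  simp only [mul_comm]

lemma norm_pairing_matVec_gram (x : ℕ → E) (p : ℕ →₀ ℂ) :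
    ‖pairing (matVec (fun k j => inner ℂ (x k) (x j)) p) p‖ =
      ‖Finsupp.linearCombination ℂ x p‖ ^ 2 := by
  rw [matVec_gram (hasSum_linearCombination x p), pairing_inner (hasSum_linearCombination x p),
    inner_self_eq_norm_sq_to_K, norm_pow, RCLike.norm_ofReal, abs_norm]

lemma cauchySeq_linearCombination_iff (x : ℕ → E) (p : ℕ → (ℕ →₀ ℂ)) :
    CauchySeq (fun n => Finsupp.linearCombination ℂ x (p n)) ↔
      ∀ ε > (0 : ℝ), ∃ N, ∀ m ≥ N, ∀ n ≥ N,
        ‖pairing (matVec (fun k j => inner ℂ (x k) (x j)) ⇑(p m - p n)) ⇑(p m - p n)‖ < ε := by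
  simp only [norm_pairing_matVec_gram, map_sub, ← dist_eq_norm, Metric.cauchySeq_iff]
  refine ⟨fun h ε hε => ?_, fun h ε hε => ?_⟩
  · obtain ⟨N, hN⟩ := h √ε (Real.sqrt_pos.2 hε)
    exact ⟨N, fun m hm n hn => (Real.lt_sqrt dist_nonneg).1 (hN m hm n hn)⟩
  · obtain ⟨N, hN⟩ := h (ε ^ 2) (by positivity)
    exact ⟨N, fun m hm n hn => lt_of_pow_lt_pow_left₀ 2 hε.le (hN m hm n hn)⟩

lemma inner_linearCombination_of_dual {x d : ℕ → E}
    (hd : ∀ j k, inner ℂ (d j) (x k) = if k = j then 1 else 0) (p : ℕ →₀ ℂ) (j : ℕ) :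
    inner ℂ (d j) (Finsupp.linearCombination ℂ x p) = p j := by
  rw [Finsupp.linearCombination_apply, Finsupp.sum, inner_sum]
  simp only [inner_smul_right, hd, mul_ite, mul_one, mul_zero, Finset.sum_ite_eq']
  exact ite_eq_left_iff.2 fun hj => (Finsupp.notMem_support_iff.1 hj).symm

lemma inner_starProjection_closedSpan [CompleteSpace E] (x : ℕ → E) (Y : E) (k : ℕ) :
    inner ℂ (x k) ((closedSpan x Set.univ).starProjection Y) = inner ℂ (x k) Y := by
  have := (closedSpan x Set.univ).sub_starProjection_mem_orthogonal Y _
    (mem_closedSpan x (Set.mem_univ k))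
  rwa [inner_sub_right, sub_eq_zero, eq_comm] at this

lemma eq_starProjection_closedSpan [CompleteSpace E] {x : ℕ → E} {X Y : E}
    (hX : X ∈ closedSpan x Set.univ) (h : ∀ k, inner ℂ (x k) X = inner ℂ (x k) Y) :
    (closedSpan x Set.univ).starProjection Y = X :=
  Submodule.eq_starProjection_of_mem_orthogonal hX <| mem_closedSpan_orthogonal.2 fun k _ => by
    rw [inner_sub_right, h, sub_self]

theorem isInverse_gram_iff [CompleteSpace E] {x d : ℕ → E} {Y : E}
    (hd : ∀ j k, inner ℂ (d j) (x k) = if k = j then 1 else 0) {c : ℕ → ℂ} {e : ℂ} :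
    IsInverse (fun k j => inner ℂ (x k) (x j)) (fun k => inner ℂ (x k) Y) c e ↔
      (c = fun j => inner ℂ (d j) ((closedSpan x Set.univ).starProjection Y)) ∧
        e = inner ℂ ((closedSpan x Set.univ).starProjection Y) Y := by
  simp only [IsInverse, ← cauchySeq_linearCombination_iff]
  simp only [matVec_gram (hasSum_linearCombination x _),
    pairing_inner (hasSum_linearCombination x _)]
  constructor
  · rintro ⟨p, hcau, hy, hc, he⟩
    obtain ⟨X, hX⟩ := cauchySeq_tendsto_of_complete hcau
    have hmem : X ∈ closedSpan x Set.univ := (isClosed_closedSpan x _).mem_of_tendsto hX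
      (.of_forall fun n => linearCombination_mem_closedSpan x fun _ _ => Set.mem_univ _)
    rw [eq_starProjection_closedSpan hmem fun k =>
      tendsto_nhds_unique (tendsto_const_nhds.inner hX) (hy k)]
    refine ⟨funext fun j => tendsto_nhds_unique (hc j) ?_,
      tendsto_nhds_unique he (hX.inner tendsto_const_nhds)⟩
    simpa only [inner_linearCombination_of_dual hd] using
      (tendsto_const_nhds (x := d j)).inner (𝕜 := ℂ) hX
  · rintro ⟨rfl, rfl⟩
    obtain ⟨p, -, hp⟩ := exists_tendsto_linearCombination
      ((closedSpan x Set.univ).starProjection_apply_mem Y)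
    refine ⟨p, hp.cauchySeq, fun k => ?_, fun j => ?_, hp.inner tendsto_const_nhds⟩
    · simpa only [inner_starProjection_closedSpan] using
        (tendsto_const_nhds (x := x k)).inner (𝕜 := ℂ) hp
    · simpa only [inner_linearCombination_of_dual hd] using
        (tendsto_const_nhds (x := d j)).inner (𝕜 := ℂ) hp

end Gram

section LittleL2

lemma tendsto_lp_apply {z : ℕ → lp (fun _ : ℕ => ℂ) 2} {t : lp (fun _ : ℕ => ℂ) 2}
    (hz : Tendsto z atTop (𝓝 t)) (k : ℕ) : Tendsto (fun n => z n k) atTop (𝓝 (t k)) :=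
  tendsto_pi_nhds.1 ((lp.uniformContinuous_coe.continuous.tendsto t).comp hz) k

lemma pairing_eq_inner_lp (z t : lp (fun _ : ℕ => ℂ) 2) : pairing z t = inner ℂ t z :=
  (lp.inner_eq_tsum t z).symm

lemma exists_finsupp_tendsto_lp (x : lp (fun _ : ℕ => ℂ) 2) :
    ∃ (p : ℕ → (ℕ →₀ ℂ)) (s : ℕ → lp (fun _ : ℕ => ℂ) 2),
      (∀ n, ⇑(s n) = ⇑(p n)) ∧ Tendsto s atTop (𝓝 x) := by
  refine ⟨fun n => ∑ j ∈ Finset.range n, Finsupp.single j (x j), _, fun n => ?_,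
    (lp.hasSum_single (by simp) x).tendsto_sum_nat⟩
  ext k
  simp only [lp.coeFn_sum, Finset.sum_apply, lp.single_apply, Finsupp.finsetSum_apply]
  refine Finset.sum_congr rfl fun j _ => ?_
  rw [Finsupp.single_apply, Pi.single_apply]
  simp only [eq_comm]

theorem isInverse_of_bounded {M : ℕ → ℕ → ℂ} {y : ℕ → ℂ}
    (T : lp (fun _ : ℕ => ℂ) 2 →L[ℂ] lp (fun _ : ℕ => ℂ) 2)
    (hT : ∀ (x : lp (fun _ : ℕ => ℂ) 2) (k : ℕ), HasSum (fun j => M k j * x j) (T x k))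
    {x : lp (fun _ : ℕ => ℂ) 2} (hx : ∀ k, T x k = y k) : IsInverse M y x (inner ℂ x (T x)) := by
  obtain rfl : ⇑(T x) = y := funext hx
  obtain ⟨p, s, hs, hlim⟩ := exists_finsupp_tendsto_lp x
  have hmat : ∀ z : lp (fun _ : ℕ => ℂ) 2, matVec M z = T z := fun z =>
    funext fun k => (hT z k).tsum_eq
  have hsub : ∀ m n, ⇑(p m - p n) = ⇑(s m - s n) := fun m n => by
    rw [lp.coeFn_sub, hs, hs, Finsupp.coe_sub]
  refine ⟨p, fun ε hε => ?_, fun k => ?_, fun j => ?_, ?_⟩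
  · obtain ⟨N, hN⟩ := Metric.cauchySeq_iff.1 hlim.cauchySeq √(ε / (‖T‖ + 1))
      (Real.sqrt_pos.2 (by positivity))
    refine ⟨N, fun m hm n hn => ?_⟩
    have hdist := hN m hm n hn
    rw [dist_eq_norm, Real.lt_sqrt (norm_nonneg _), lt_div_iff₀ (by positivity)] at hdist
    rw [hsub, hmat, pairing_eq_inner_lp]
    calc ‖inner ℂ (s m - s n) (T (s m - s n))‖
        ≤ ‖s m - s n‖ * (‖T‖ * ‖s m - s n‖) :=
          (norm_inner_le_norm _ _).trans (by gcongr; exact T.le_opNorm _)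
      _ ≤ ‖s m - s n‖ ^ 2 * (‖T‖ + 1) := by nlinarith [sq_nonneg ‖s m - s n‖]
      _ < ε := hdist
  · simpa only [← hs, hmat, Function.comp_apply] using
      tendsto_lp_apply ((T.continuous.tendsto x).comp hlim) k
  · simpa only [← hs] using tendsto_lp_apply hlim j
  · simpa only [← hs, pairing_eq_inner_lp] using hlim.inner (tendsto_const_nhds (x := T x))

end LittleL2

/-! ### Square summable Fourier coefficients -/

lemma orthonormal_wex_oneWeight : Orthonormal ℂ fun j : ℕ => wex oneWeight j :=
  orthonormal_iff_ite.2 fun i j => by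
    rw [isReciprocal_oneWeight.inner_wex_wex]
    simp only [Nat.cast_inj, eq_comm]

lemma memℓp_fourierCoef {φ : ℝ → ℂ} (hφ : MemLp φ 2 circProb) :
    Memℓp (fun j : ℕ => fourierCoef φ j) 2 := by
  have hsum := orthonormal_wex_oneWeight.inner_products_summable (hφ.toLp φ)
  simp only [inner_wex_oneWeight, fourierCoef_congr hφ.coeFn_toLp] at hsum
  exact memℓp_gen (by simpa using hsum)

section FourierSum

variable {c : ℕ → ℂ} {C : ℝ → ℂ}

lemma summable_smul_wex_oneWeight (hc : Memℓp c 2) :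
    Summable fun j : ℕ => c j • wex oneWeight j := by
  simpa using (orthonormal_wex_oneWeight.orthogonalFamily.hasSum_linearIsometry
    (⟨c, hc⟩ : lp (fun _ : ℕ => ℂ) 2)).summable

lemma isFourierSum_of_hasSum {z : CircleL2} (hz : HasSum (fun j : ℕ => c j • wex oneWeight j) z) :
    IsFourierSum c z := by
  have hcoef : ∀ k, HasSum (fun j : ℕ => if (j : ℤ) = k then c j else 0) (fourierCoef z k) :=
    fun k => by
      simpa only [innerSL_apply_apply, inner_smul_right, isReciprocal_oneWeight.inner_wex_wex,
        mul_ite, mul_one, mul_zero, inner_wex_oneWeight] using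
        hz.mapL (innerSL ℂ (wex oneWeight k))
  refine ⟨integrable_circProb.1 ((Lp.memLp z).integrable one_le_two), fun j => ?_, fun k hk => ?_⟩
  · refine (hcoef j).unique ?_
    convert hasSum_ite_eq j (c j) using 2 with i
    aesop
  · refine (hcoef k).unique ?_
    simpa only [(hk.trans_le (Int.natCast_nonneg _)).ne', if_false] using hasSum_zero

lemma IsFourierSum.exists_hasSum (h : IsFourierSum c C) (hc : Memℓp c 2) :
    ∃ z : CircleL2, HasSum (fun j : ℕ => c j • wex oneWeight j) z ∧ z =ᵐ[circProb] C := by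
  obtain ⟨z, hz⟩ := summable_smul_wex_oneWeight hc
  refine ⟨z, hz, ?_⟩
  rw [EventuallyEq, ae_circProb]
  exact h.ae_eq (isFourierSum_of_hasSum hz)

lemma IsFourierSum.hasSum_mul_conj (h : IsFourierSum c C) (hc : Memℓp c 2) {φ : ℝ → ℂ}
    (hφ : MemLp φ 2 circProb) :
    HasSum (fun k : ℕ => fourierCoef φ k * conj (c k)) (mean fun θ => φ θ * conj (C θ)) := by
  obtain ⟨z, hz, hzC⟩ := h.exists_hasSum hc
  have hmean : inner ℂ z (hφ.toLp φ) = mean fun θ => φ θ * conj (C θ) := by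
    rw [L2.inner_def, mean_eq_integral]
    refine integral_congr_ae ?_
    filter_upwards [hzC, hφ.coeFn_toLp] with θ hCθ hφθ
    rw [RCLike.inner_apply, hCθ, hφθ]
  have hsum := (hz.mapL (innerSL ℂ (hφ.toLp φ))).star
  simp only [innerSL_apply_apply, inner_smul_right, star_mul', RCLike.star_def, inner_conj_symm,
    inner_wex_oneWeight, fourierCoef_congr hφ.coeFn_toLp, hmean] at hsum
  simpa only [mul_comm] using hsum

lemma IsFourierSum.tendsto_sqDist (h : IsFourierSum c C) (hc : Memℓp c 2) :
    Tendsto (fun n => sqDist (fun _ => 1) fun θ => C θ - ∑ j ∈ Finset.range n, c j * ex j θ)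
      atTop (𝓝 0) := by
  obtain ⟨z, hz, hzC⟩ := h.exists_hasSum hc
  let p : ℕ → (ℤ →₀ ℂ) := fun n => ∑ j ∈ Finset.range n, Finsupp.single (j : ℤ) (c j)
  have hp : ∀ n θ, trigPoly (p n) θ = ∑ j ∈ Finset.range n, c j * ex j θ := fun n θ => by
    rw [trigPoly, ← Finsupp.sum_finsetSum_index (by simp) fun k s t => add_mul s t _]
    simp only [Finsupp.sum_single_index, zero_mul]
  have hsq : ∀ᵐ θ ∂circProb, oneWeight θ ^ 2 = 1 := coeFn_oneWeight.mono fun θ hθ => by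
    rw [hθ, one_pow]
  have hzC' : z =ᵐ[circProb] fun θ => C θ * oneWeight θ := by
    filter_upwards [hzC, coeFn_oneWeight] with θ hCθ hθ
    rw [hCθ, hθ, Complex.ofReal_one, mul_one]
  simp only [← hp]
  refine (tendsto_sqDist_iff_of_ae_eq hsq hzC' p).2 ?_
  simpa only [p, map_sum, Finsupp.linearCombination_single] using hz.tendsto_sum_nat

end FourierSum

/-! ### Absolutely summable symbols -/

section Symbol

variable {a : ℕ → ℂ}

lemma norm_symbolA_le (ha : Summable fun j => ‖a j‖) (θ : ℝ) : ‖symbolA a θ‖ ≤ ∑' j, ‖a j‖ :=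
  tsum_of_norm_bounded ha.hasSum fun j => by rw [norm_mul, norm_ex, mul_one]

lemma continuous_symbolA (ha : Summable fun j => ‖a j‖) : Continuous (symbolA a) :=
  continuous_tsum (fun j => continuous_const.mul (continuous_ex j)) ha
    fun j θ => by rw [norm_mul, norm_ex, mul_one]

lemma integrable_symbolA_mul (ha : Summable fun j => ‖a j‖) {φ : ℝ → ℂ}
    (hφ : Integrable φ circProb) : Integrable (fun θ => symbolA a θ * φ θ) circProb :=
  hφ.bdd_mul (continuous_symbolA ha).aestronglyMeasurable (.of_forall (norm_symbolA_le ha))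

lemma integrable_norm_symbolA_sq_mul (ha : Summable fun j => ‖a j‖) {s : ℝ → ℝ}
    (hs : Integrable s circProb) : Integrable (fun θ => ‖symbolA a θ‖ ^ 2 * s θ) circProb :=
  hs.bdd_mul ((continuous_symbolA ha).norm.pow 2).aestronglyMeasurable <| .of_forall fun θ => by
    rw [norm_pow, norm_norm]
    exact pow_le_pow_left₀ (norm_nonneg _) (norm_symbolA_le ha θ) 2

lemma hasSum_fourierCoef_symbolA_mul (ha : Summable fun j => ‖a j‖) {φ : ℝ → ℂ}
    (hφ : Integrable φ circProb) (k : ℤ) :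
    HasSum (fun j : ℕ => a j * fourierCoef φ (k - j))
      (fourierCoef (fun θ => symbolA a θ * φ θ) k) := by
  have hsum := hasSum_integral_of_summable_integral_norm (μ := circProb)
    (F := fun (j : ℕ) θ => a j * (φ θ * ex (-(k - j)) θ))
    (fun j => (integrable_mul_ex hφ _).const_mul _) (by
      simp only [norm_mul, norm_ex, mul_one, integral_const_mul]
      exact ha.mul_right _)
  have hpoint : ∀ θ, ∑' j : ℕ, a j * (φ θ * ex (-(k - j)) θ) =
      symbolA a θ * φ θ * ex (-k) θ := fun θ => by
    simp only [symbolA, ← tsum_mul_right]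
    refine tsum_congr fun j => ?_
    rw [neg_sub, sub_eq_add_neg, ex_add]
    ring
  simpa only [integral_const_mul, ← fourierCoef_eq_integral, hpoint] using hsum

lemma toeplitz_eq_fourierCoef (s : ℝ → ℝ) (k j : ℕ) :
    toeplitz s k j = fourierCoef (fun θ => (s θ : ℂ)) (k - j) := by
  simp only [toeplitz, fourierCoef, neg_sub, mul_comm]

lemma matVec_toeplitz (ha : Summable fun j => ‖a j‖) {s : ℝ → ℝ} (hs : Integrable s circProb) :
    matVec (toeplitz s) a = fun k : ℕ => fourierCoef (fun θ => symbolA a θ * s θ) k := by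
  ext k
  have hsum := hasSum_fourierCoef_symbolA_mul ha (φ := fun θ => (s θ : ℂ)) hs.ofReal k
  rw [matVec, ← hsum.tsum_eq]
  simp only [toeplitz_eq_fourierCoef, mul_comm]

lemma pairing_toeplitz (ha : Summable fun j => ‖a j‖) {s : ℝ → ℝ} (hs : Integrable s circProb) :
    pairing (matVec (toeplitz s) a) a = (∫ θ, ‖symbolA a θ‖ ^ 2 * s θ ∂circProb : ℝ) := by
  have hint : Integrable (fun θ => symbolA a θ * (s θ : ℂ)) circProb :=
    integrable_symbolA_mul ha hs.ofReal
  have hsum := hasSum_fourierCoef_symbolA_mul ha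
    (Complex.conjCLE.toContinuousLinearMap.integrable_comp hint) 0
  simp only [zero_sub, ContinuousLinearEquiv.coe_coe, Complex.conjCLE_apply, fourierCoef_conj,
    neg_neg] at hsum
  have hpair := hsum.star.tsum_eq
  simp only [star_mul', RCLike.star_def, Complex.conj_conj] at hpair
  simp only [matVec_toeplitz ha hs, pairing, mul_comm _ (conj _)]
  rw [hpair, fourierCoef_eq_integral, ← integral_conj, ← integral_complex_ofReal]
  refine integral_congr_ae (.of_forall fun θ => ?_)
  simp only [neg_zero, ex_zero, mul_one, map_mul, Complex.conj_conj, Complex.ofReal_mul,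
    Complex.ofReal_pow, Complex.conj_ofReal]
  rw [← mul_assoc, Complex.conj_mul']

end Symbol

/-! ### Stationary sequences -/

section Stationary

variable {Ω : Type*} [MeasurableSpace Ω] {P : Measure Ω} {ξ η : ℤ → Ω → ℂ} {f g : ℝ → ℝ}
  {a : ℕ → ℂ}

lemma inner_toLp_toLp {X Y : Ω → ℂ} (hX : MemLp X 2 P) (hY : MemLp Y 2 P) :
    inner ℂ (hX.toLp X) (hY.toLp Y) = ∫ ω, Y ω * conj (X ω) ∂P := by
  rw [L2.inner_def]
  refine integral_congr_ae ?_
  filter_upwards [hX.coeFn_toLp, hY.coeFn_toLp] with ω hXω hYω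
  rw [hXω, hYω, RCLike.inner_apply]

lemma integral_mul_conj_eq_zero_of_indepFun (hξ : IsStationary P ξ f) (hη : IsStationary P η g)
    (hind : IndepFun (fun ω k => ξ k ω) (fun ω k => η k ω) P) (m n : ℤ) :
    ∫ ω, ξ m ω * conj (η n ω) ∂P = 0 := by
  have hind_mn : IndepFun (ξ m) (fun ω => conj (η n ω)) P :=
    hind.comp (φ := fun x : ℤ → ℂ => x m) (ψ := fun x : ℤ → ℂ => conj (x n))
      (measurable_pi_apply m)
      (Complex.continuous_conj.measurable.comp (measurable_pi_apply n))
  rw [hind_mn.integral_fun_mul_eq_mul_integral (hξ.memLp m).1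
    (Complex.continuous_conj.comp_aestronglyMeasurable (hη.memLp n).1), hξ.centred, zero_mul]

namespace IsStationary

lemma inner_toL2 (hξ : IsStationary P ξ f) (m n : ℤ) :
    inner ℂ (hξ.toL2 m) (hξ.toL2 n) = mean fun θ => ex (n - m) θ * (f θ : ℂ) := by
  rw [toL2, toL2, inner_toLp_toLp, hξ.cov]

lemma inner_toL2_eq_fourierCoef (hξ : IsStationary P ξ f) (m n : ℤ) :
    inner ℂ (hξ.toL2 m) (hξ.toL2 n) = fourierCoef (fun θ => (f θ : ℂ)) (m - n) := by
  simp only [inner_toL2, fourierCoef, neg_sub, mul_comm]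

lemma norm_toL2 (hξ : IsStationary P ξ f) (k : ℤ) : ‖hξ.toL2 k‖ = ‖hξ.toL2 0‖ := by
  simp only [norm_eq_sqrt_re_inner (𝕜 := ℂ), inner_toL2, sub_self]

lemma summable_smul_toL2 (hξ : IsStationary P ξ f) (ha : Summable fun j => ‖a j‖) :
    Summable fun j : ℕ => a j • hξ.toL2 j :=
  .of_norm <| by simpa only [norm_smul, hξ.norm_toL2] using ha.mul_right _

lemma inner_toL2_tsum (hξ : IsStationary P ξ f) (ha : Summable fun j => ‖a j‖) (k : ℤ) :
    inner ℂ (hξ.toL2 k) (∑' j : ℕ, a j • hξ.toL2 j) =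
      fourierCoef (fun θ => symbolA a θ * f θ) k := by
  have hsum := (hξ.summable_smul_toL2 ha).hasSum.mapL (innerSL ℂ (hξ.toL2 k))
  simp only [innerSL_apply_apply, inner_smul_right, inner_toL2_eq_fourierCoef] at hsum
  exact hsum.unique (hasSum_fourierCoef_symbolA_mul ha (φ := fun θ => (f θ : ℂ))
    (integrable_circProb.2 hξ.integrable).ofReal k)

lemma norm_tsum_toL2_sq (hξ : IsStationary P ξ f) (ha : Summable fun j => ‖a j‖) :
    ‖∑' j : ℕ, a j • hξ.toL2 j‖ ^ 2 = ∫ θ, ‖symbolA a θ‖ ^ 2 * f θ ∂circProb := by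
  have hgram : toeplitz f = fun k j : ℕ => inner ℂ (hξ.toL2 k) (hξ.toL2 j) := by
    funext k j
    rw [inner_toL2, toeplitz]
  have hS := (hξ.summable_smul_toL2 ha).hasSum
  have hpair := pairing_toeplitz ha (integrable_circProb.2 hξ.integrable)
  rw [hgram, matVec_gram hS, pairing_inner hS, inner_self_eq_norm_sq_to_K] at hpair
  exact Complex.ofReal_injective ((Complex.ofReal_pow _ _).trans hpair)

variable (hξ : IsStationary P ξ f) (hη : IsStationary P η g)
  (hunc : ∀ m n, ∫ ω, ξ m ω * conj (η n ω) ∂P = 0)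
include hunc

lemma inner_toL2_of_uncorrelated (m n : ℤ) : inner ℂ (hη.toL2 n) (hξ.toL2 m) = 0 := by
  rw [toL2, toL2, inner_toLp_toLp, hunc]

lemma inner_add_toL2 (m n : ℤ) :
    inner ℂ (hξ.toL2 m + hη.toL2 m) (hξ.toL2 n + hη.toL2 n) =
      mean fun θ => ex (n - m) θ * ((f θ + g θ : ℝ) : ℂ) := by
  have hzero : inner ℂ (hξ.toL2 m) (hη.toL2 n) = 0 :=
    inner_eq_zero_symm.1 (inner_toL2_of_uncorrelated hξ hη hunc m n)
  rw [inner_add_left, inner_add_right, inner_add_right, hzero,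
    inner_toL2_of_uncorrelated hξ hη hunc, zero_add, add_zero, inner_toL2, inner_toL2]
  simp only [mean_eq_integral, Complex.ofReal_add, mul_comm (ex _ _), add_mul]
  exact (integral_add
    (integrable_mul_ex (integrable_circProb.2 hξ.integrable).ofReal _)
    (integrable_mul_ex (integrable_circProb.2 hη.integrable).ofReal _)).symm

lemma inner_add_toL2_tsum (ha : Summable fun j => ‖a j‖) (k : ℤ) :
    inner ℂ (hξ.toL2 k + hη.toL2 k) (∑' j : ℕ, a j • hξ.toL2 j) =
      fourierCoef (fun θ => symbolA a θ * f θ) k := by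
  have hsum := (hξ.summable_smul_toL2 ha).hasSum.mapL (innerSL ℂ (hη.toL2 k))
  simp only [innerSL_apply_apply, inner_smul_right, inner_toL2_of_uncorrelated hξ hη hunc,
    mul_zero] at hsum
  rw [inner_add_left, hξ.inner_toL2_tsum ha, hsum.unique hasSum_zero, add_zero]

end IsStationary

end Stationary

/-! ### The spectral characteristic -/

section Estimation

variable {f g : ℝ → ℝ} {v u : Lp ℝ 2 circProb} {a : ℕ → ℂ}

/-- The spectral characteristic of the best estimate of `∑ a_j ξ_j` from all the `ξ_k + η_k`,
`k ∈ ℤ`, that is, of the two-sided Wiener filter. The estimate from the past is computed by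
approximating it in `L²(f + g)`. -/
def wienerFilter (f g : ℝ → ℝ) (a : ℕ → ℂ) (θ : ℝ) : ℂ :=
  symbolA a θ * (f θ / (f θ + g θ) : ℝ)

/-- The function `C(θ) = ∑_{j ≥ 0} c_j e^{ijθ}` with `c = B⁻¹ y`, where `B` is the Toeplitz matrix
of `u²`, `y_k = ⟨u e^{ikθ}, Y⟩`, and `v` is the reciprocal of `u`. -/
def inverseSeries (v u : Lp ℝ 2 circProb) (Y : CircleL2) (θ : ℝ) : ℂ :=
  dualProj u Y θ * v θ

lemma integrable_inverseSeries (v u : Lp ℝ 2 circProb) (Y : CircleL2) :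
    Integrable (inverseSeries v u Y) circProb :=
  integrable_mul_weight v (dualProj u Y)

lemma fourierCoef_inverseSeries (v u : Lp ℝ 2 circProb) (Y : CircleL2) (k : ℤ) :
    fourierCoef (inverseSeries v u Y) k = inner ℂ (wex v k) (dualProj u Y) :=
  (inner_wex v k _).symm

lemma isFourierSum_inverseSeries (h : IsReciprocal v u) (Y : CircleL2) :
    IsFourierSum (fun j : ℕ => fourierCoef (inverseSeries v u Y) j) (inverseSeries v u Y) :=
  ⟨integrable_circProb.1 (integrable_inverseSeries v u Y), fun _ => rfl, fun k hk => by
    rw [fourierCoef_inverseSeries, inner_wex_dualProj_of_neg h Y hk]⟩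

lemma dualProj_ae_eq (h : IsReciprocal v u) (Y : CircleL2) :
    dualProj u Y =ᵐ[circProb] fun θ => inverseSeries v u Y θ * u θ := by
  filter_upwards [h] with θ hθ
  rw [inverseSeries, mul_assoc, ← Complex.ofReal_mul, hθ, Complex.ofReal_one, mul_one]

lemma IsReciprocal.sq_eq_inv {w : ℝ → ℝ} (h : IsReciprocal v u)
    (hv : ∀ᵐ θ ∂circProb, v θ ^ 2 = w θ) : ∀ᵐ θ ∂circProb, u θ ^ 2 = (w θ)⁻¹ := by
  filter_upwards [h, hv] with θ hθ hvθ
  rw [← hvθ, eq_inv_of_mul_eq_one_right hθ, inv_pow]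

lemma toeplitz_eq_gram {s : ℝ → ℝ} (hu : ∀ᵐ θ ∂circProb, u θ ^ 2 = s θ) :
    toeplitz s = fun k j : ℕ => inner ℂ (wex u k) (wex u j) := by
  funext k j
  rw [inner_wex_wex, toeplitz, mean_eq_integral, mean_eq_integral]
  refine integral_congr_ae ?_
  filter_upwards [hu] with θ hθ
  rw [← hθ, sq]

theorem isInverse_toeplitz_iff {s : ℝ → ℝ} (h : IsReciprocal v u)
    (hu : ∀ᵐ θ ∂circProb, u θ ^ 2 = s θ) (Y : CircleL2) {c : ℕ → ℂ} {e : ℂ} :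
    IsInverse (toeplitz s) (fun k : ℕ => inner ℂ (wex u k) Y) c e ↔
      (c = fun j : ℕ => fourierCoef (inverseSeries v u Y) j) ∧
        e = inner ℂ (dualProj u Y) Y := by
  have hspan : closedSpan (fun k : ℕ => wex u k) Set.univ = closedSpan (wex u) (Set.Ici 0) := by
    have hrange : Set.range ((↑) : ℕ → ℤ) = Set.Ici 0 := Set.ext fun k =>
      ⟨fun ⟨n, hn⟩ => hn ▸ Int.natCast_nonneg n, fun hk => ⟨k.toNat, Int.toNat_of_nonneg hk⟩⟩
    rw [← hrange]
    exact closedSpan_comp (wex u) Nat.cast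
  have hdual : ∀ j k : ℕ, inner ℂ (wex v j) (wex u k) = if k = j then 1 else 0 := fun j k => by
    simp only [h.symm.inner_wex_wex, Nat.cast_inj]
  rw [toeplitz_eq_gram hu, isInverse_gram_iff hdual]
  simp only [hspan, fourierCoef_inverseSeries, dualProj]

lemma inner_dualProj_self (u : Lp ℝ 2 circProb) (Y : CircleL2) :
    inner ℂ (dualProj u Y) Y = ((‖dualProj u Y‖ ^ 2 : ℝ) : ℂ) := by
  have horth : inner ℂ (dualProj u Y) (Y - dualProj u Y) = 0 :=
    Submodule.inner_right_of_mem_orthogonal (Submodule.starProjection_apply_mem _ _)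
      (Submodule.sub_starProjection_mem_orthogonal Y)
  rw [inner_sub_right, sub_eq_zero] at horth
  rw [horth, Complex.ofReal_pow]
  exact inner_self_eq_norm_sq_to_K _

lemma memLp_inverseSeries {K : ℝ} (hK : ∀ᵐ θ ∂circProb, v θ ^ 2 ≤ K) (Y : CircleL2) :
    MemLp (inverseSeries v u Y) 2 circProb := by
  refine ((Lp.memLp (dualProj u Y)).const_mul (√K : ℂ)).mono
    (integrable_inverseSeries v u Y).1 ?_
  filter_upwards [hK] with θ hθ
  rw [inverseSeries, norm_mul, norm_mul, mul_comm, Complex.norm_real, Complex.norm_real,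
    Real.norm_of_nonneg (Real.sqrt_nonneg K)]
  gcongr
  exact Real.abs_le_sqrt hθ

lemma integrable_norm_sq_mul_of_ae_eq {s : ℝ → ℝ} (hv : ∀ᵐ θ ∂circProb, v θ ^ 2 = s θ)
    {z : CircleL2} {φ : ℝ → ℂ} (hz : z =ᵐ[circProb] fun θ => φ θ * v θ) :
    Integrable (fun θ => ‖φ θ‖ ^ 2 * s θ) circProb := by
  refine ((Lp.memLp z).integrable_norm_pow two_ne_zero).congr ?_
  filter_upwards [hv, hz] with θ hθ hzθ
  rw [hzθ, norm_mul, mul_pow, Complex.norm_real, Real.norm_eq_abs, sq_abs, hθ]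

lemma norm_sq_eq_integral_of_ae_eq {s : ℝ → ℝ} (hv : ∀ᵐ θ ∂circProb, v θ ^ 2 = s θ)
    {z : CircleL2} {φ : ℝ → ℂ} (hz : z =ᵐ[circProb] fun θ => φ θ * v θ) :
    ‖z‖ ^ 2 = ∫ θ, ‖φ θ‖ ^ 2 * s θ ∂circProb := by
  have hinner := inner_self_eq_norm_sq_to_K (𝕜 := ℂ) z
  rw [L2.inner_def] at hinner
  refine Complex.ofReal_injective ?_
  rw [Complex.ofReal_pow, ← integral_complex_ofReal]
  refine hinner.symm.trans (integral_congr_ae ?_)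
  filter_upwards [hv, hz] with θ hθ hzθ
  rw [inner_self_eq_norm_sq_to_K, hzθ, norm_mul, ← hθ, ← sq_abs (v θ), Complex.norm_real]
  push_cast
  exact mul_pow _ _ _

lemma exists_ae_eq_mul_weight {m : ℝ → ℂ} (hm : MemLp m ∞ circProb) (v : Lp ℝ 2 circProb) :
    ∃ Y : CircleL2, Y =ᵐ[circProb] fun θ => m θ * v θ := by
  refine ⟨mulL hm (wex v 0), ?_⟩
  filter_upwards [coeFn_mulL hm (wex v 0), coeFn_wex v 0] with θ hmul hwex
  rw [hmul, hwex, ex_zero, one_mul]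

lemma memLp_div_add (hf : AEStronglyMeasurable f circProb) (hg : AEStronglyMeasurable g circProb)
    (hf0 : ∀ᵐ θ ∂circProb, 0 ≤ f θ) (hg0 : ∀ᵐ θ ∂circProb, 0 ≤ g θ) :
    MemLp (fun θ => f θ / (f θ + g θ)) ∞ circProb := by
  refine memLp_top_of_bound
    (hf.aemeasurable.div (hf.add hg).aemeasurable).aestronglyMeasurable 1 ?_
  filter_upwards [hf0, hg0] with θ hfθ hgθ
  rw [Real.norm_of_nonneg (by positivity)]
  exact div_le_one_of_le₀ (le_add_of_nonneg_right hgθ) (add_nonneg hfθ hgθ)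

lemma memLp_wienerFilter (hdiv : MemLp (fun θ => f θ / (f θ + g θ)) ∞ circProb)
    (ha : Summable fun j => ‖a j‖) : MemLp (wienerFilter f g a) ∞ circProb :=
  hdiv.ofReal.mul' <| memLp_top_of_bound (continuous_symbolA ha).aestronglyMeasurable _
    (.of_forall (norm_symbolA_le ha))

section Weight

variable (h : IsReciprocal v u) (hv : ∀ᵐ θ ∂circProb, v θ ^ 2 = f θ + g θ)
include h hv

lemma IsReciprocal.add_ne_zero : ∀ᵐ θ ∂circProb, f θ + g θ ≠ 0 := by
  filter_upwards [h, hv] with θ hθ hvθ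
  rw [← hvθ]
  exact pow_ne_zero 2 (left_ne_zero_of_mul_eq_one hθ)

variable {Y : CircleL2} (hY : Y =ᵐ[circProb] fun θ => wienerFilter f g a θ * v θ)
include hY

lemma inner_wex_eq_fourierCoef_symbolA_mul (k : ℤ) :
    inner ℂ (wex v k) Y = fourierCoef (fun θ => symbolA a θ * f θ) k := by
  rw [inner_wex]
  refine fourierCoef_congr ?_ k
  filter_upwards [hv, h.add_ne_zero hv, hY] with θ hvθ h0 hYθ
  rw [hYθ, mul_assoc, ← sq, ← Complex.ofReal_pow, hvθ, wienerFilter, mul_assoc,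
    ← Complex.ofReal_mul, div_mul_cancel₀ _ h0]

omit hv in
lemma inner_wex_eq_fourierCoef_wienerFilter (k : ℤ) :
    inner ℂ (wex u k) Y = fourierCoef (wienerFilter f g a) k := by
  rw [inner_wex]
  refine fourierCoef_congr ?_ k
  filter_upwards [h, hY] with θ hθ hYθ
  rw [hYθ, mul_assoc, ← Complex.ofReal_mul, hθ, Complex.ofReal_one, mul_one]

omit h hv in
lemma inner_dualProj_eq_mean (u : Lp ℝ 2 circProb) :
    inner ℂ (dualProj u Y) Y =
      mean fun θ => wienerFilter f g a θ * conj (inverseSeries v u Y θ) := by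
  rw [L2.inner_def, mean_eq_integral]
  refine integral_congr_ae ?_
  filter_upwards [hY] with θ hYθ
  rw [RCLike.inner_apply, hYθ, inverseSeries, map_mul, Complex.conj_ofReal]
  ring

lemma sub_dualProj_ae_eq : (Y - dualProj u Y : CircleL2) =ᵐ[circProb] fun θ =>
    (symbolA a θ * f θ - inverseSeries v u Y θ) / (f θ + g θ) * v θ := by
  filter_upwards [Lp.coeFn_sub Y (dualProj u Y), hY, dualProj_ae_eq h Y, h, hv,
    h.add_ne_zero hv] with θ hsub hYθ hXθ hθ hvθ h0
  have hu : (u θ : ℂ) = v θ / (f θ + g θ) := by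
    rw [eq_div_iff (by exact_mod_cast h0), ← Complex.ofReal_add, ← hvθ]
    norm_cast
    linear_combination v θ * hθ
  rw [hsub, Pi.sub_apply, hYθ, hXθ, hu, wienerFilter]
  push_cast
  ring

lemma integral_norm_symbolA_sq_mul_sub (hf : Integrable f circProb)
    (ha : Summable fun j => ‖a j‖) :
    (∫ θ, ‖symbolA a θ‖ ^ 2 * f θ ∂circProb) - ‖Y‖ ^ 2 =
      ∫ θ, ‖symbolA a θ‖ ^ 2 * (f θ * g θ / (f θ + g θ)) ∂circProb := by
  rw [norm_sq_eq_integral_of_ae_eq hv hY, ← integral_sub (integrable_norm_symbolA_sq_mul ha hf)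
    (integrable_norm_sq_mul_of_ae_eq hv hY)]
  refine integral_congr_ae ?_
  filter_upwards [h.add_ne_zero hv] with θ h0
  rw [wienerFilter, norm_mul, mul_pow, Complex.norm_real, Real.norm_eq_abs, sq_abs]
  field_simp
  ring

end Weight

section Error

variable {α : Type*} [MeasurableSpace α] {μ : Measure α} {f g : α → ℝ} {A C : α → ℂ}

lemma norm_add_sq_mul_add_norm_sub_sq_mul (z w : ℂ) {x y : ℝ} (h : x + y ≠ 0) :
    ‖z * y + w‖ ^ 2 / (x + y) ^ 2 * x + ‖z * x - w‖ ^ 2 / (x + y) ^ 2 * y =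
      ‖z‖ ^ 2 * (x * y / (x + y)) + ‖w‖ ^ 2 * (x + y)⁻¹ := by
  simp only [Complex.sq_norm, Complex.normSq_apply, Complex.add_re, Complex.add_im,
    Complex.sub_re, Complex.sub_im, Complex.re_mul_ofReal, Complex.im_mul_ofReal]
  field_simp
  ring

variable (hA : AEStronglyMeasurable A μ) (hC : AEStronglyMeasurable C μ)
  (hf : AEStronglyMeasurable f μ) (hg : AEStronglyMeasurable g μ)
  (hf0 : ∀ᵐ θ ∂μ, 0 ≤ f θ) (hg0 : ∀ᵐ θ ∂μ, 0 ≤ g θ) (hfg : ∀ᵐ θ ∂μ, f θ + g θ ≠ 0)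
  (hAi : Integrable (fun θ => ‖A θ‖ ^ 2 * (f θ * g θ / (f θ + g θ))) μ)
  (hCi : Integrable (fun θ => ‖C θ‖ ^ 2 * (f θ + g θ)⁻¹) μ)
include hA hC hf hg hf0 hg0 hfg hAi hCi

lemma integrable_norm_add_sq_and_integrable_norm_sub_sq :
    Integrable (fun θ => ‖A θ * g θ + C θ‖ ^ 2 / (f θ + g θ) ^ 2 * f θ) μ ∧
      Integrable (fun θ => ‖A θ * f θ - C θ‖ ^ 2 / (f θ + g θ) ^ 2 * g θ) μ := by
  have hmeas : AEStronglyMeasurable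
      (fun θ => ‖A θ * g θ + C θ‖ ^ 2 / (f θ + g θ) ^ 2 * f θ) μ :=
    (((((hA.mul (Complex.continuous_ofReal.comp_aestronglyMeasurable hg)).add
      hC).norm.pow 2).aemeasurable.div ((hf.add hg).pow 2).aemeasurable).mul
        hf.aemeasurable).aestronglyMeasurable
  rw [← integrable_add_iff_of_nonneg hmeas]
  · refine (hAi.add hCi).congr ?_
    filter_upwards [hfg] with θ h0
    exact (norm_add_sq_mul_add_norm_sub_sq_mul (A θ) (C θ) h0).symm
  · filter_upwards [hf0] with θ hfθ using mul_nonneg (by positivity) hfθ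
  · filter_upwards [hg0] with θ hgθ using mul_nonneg (by positivity) hgθ

lemma integral_norm_add_sq_add_integral_norm_sub_sq :
    (∫ θ, ‖A θ * g θ + C θ‖ ^ 2 / (f θ + g θ) ^ 2 * f θ ∂μ) +
        ∫ θ, ‖A θ * f θ - C θ‖ ^ 2 / (f θ + g θ) ^ 2 * g θ ∂μ =
      (∫ θ, ‖A θ‖ ^ 2 * (f θ * g θ / (f θ + g θ)) ∂μ) + ∫ θ, ‖C θ‖ ^ 2 * (f θ + g θ)⁻¹ ∂μ := by
  have hint := integrable_norm_add_sq_and_integrable_norm_sub_sq hA hC hf hg hf0 hg0 hfg hAi hCi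
  rw [← integral_add hint.1 hint.2, ← integral_add hAi hCi]
  refine integral_congr_ae ?_
  filter_upwards [hfg] with θ h0
  exact norm_add_sq_mul_add_norm_sub_sq_mul (A θ) (C θ) h0

end Error

end Estimation

section Main

variable {Ω : Type*} [MeasurableSpace Ω] {P : Measure Ω} {ξ η : ℤ → Ω → ℂ} {f g : ℝ → ℝ}
  {v u : Lp ℝ 2 circProb} {a : ℕ → ℂ} {Y : CircleL2}

lemma integrable_mul_div_add (hg : Integrable g circProb)
    (hdiv : MemLp (fun θ => f θ / (f θ + g θ)) ∞ circProb) :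
    Integrable (fun θ => f θ * g θ / (f θ + g θ)) circProb :=
  (hg.mul_of_top_right hdiv).congr (.of_forall fun _ => (mul_div_right_comm _ _ _).symm)

lemma exists_linearIsometry_observations (hξ : IsStationary P ξ f) (hη : IsStationary P η g)
    (hunc : ∀ m n, ∫ ω, ξ m ω * conj (η n ω) ∂P = 0)
    (hv : ∀ᵐ θ ∂circProb, v θ ^ 2 = f θ + g θ) (hv0 : ∀ᵐ θ ∂circProb, v θ ≠ 0) :
    ∃ U : CircleL2 →ₗᵢ[ℂ] Lp ℂ 2 P, ∀ k, U (wex v k) = hξ.toL2 k + hη.toL2 k := by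
  refine exists_linearIsometry_of_inner_eq (closedSpan_wex_univ hv0) fun m n => ?_
  rw [IsStationary.inner_add_toL2 hξ hη hunc, inner_wex_wex, mean_eq_integral, mean_eq_integral]
  refine integral_congr_ae ?_
  filter_upwards [hv] with θ hθ
  rw [← hθ, sq]

lemma isSpectralIntegral_iff_ae_eq {ζ : ℤ → Lp ℂ 2 P} {U : CircleL2 →ₗᵢ[ℂ] Lp ℂ 2 P}
    (hU : ∀ k, U (wex v k) = ζ k) {w : ℝ → ℝ} (hv : ∀ᵐ θ ∂circProb, v θ ^ 2 = w θ)
    (hv0 : ∀ᵐ θ ∂circProb, v θ ≠ 0) {z : CircleL2} {φ : ℝ → ℂ}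
    (hz : z =ᵐ[circProb] fun θ => φ θ * v θ) (h : ℝ → ℂ) :
    IsSpectralIntegral ζ w h (U z) ↔ h =ᵐ[circ] φ := by
  rw [isSpectralIntegral_iff hU hv hv0, EventuallyEq, EventuallyEq, ← ae_circProb]
  refine eventually_congr ?_
  filter_upwards [hz, hv0] with θ hzθ h0
  rw [hzθ, mul_left_inj' (Complex.ofReal_ne_zero.2 h0), eq_comm]

lemma inner_observation_tsum_toL2 (hξ : IsStationary P ξ f) (hη : IsStationary P η g)
    (hunc : ∀ m n, ∫ ω, ξ m ω * conj (η n ω) ∂P = 0) (ha : Summable fun j => ‖a j‖)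
    (h : IsReciprocal v u) (hv : ∀ᵐ θ ∂circProb, v θ ^ 2 = f θ + g θ)
    (hY : Y =ᵐ[circProb] fun θ => wienerFilter f g a θ * v θ) (k : ℤ) :
    inner ℂ (hξ.toL2 k + hη.toL2 k) (∑' j : ℕ, a j • hξ.toL2 j) = inner ℂ (wex v k) Y := by
  rw [IsStationary.inner_add_toL2_tsum hξ hη hunc ha,
    inner_wex_eq_fourierCoef_symbolA_mul h hv hY]

lemma optimalEstimate_tsum_eq (hξ : IsStationary P ξ f) (hη : IsStationary P η g)
    (hunc : ∀ m n, ∫ ω, ξ m ω * conj (η n ω) ∂P = 0) (ha : Summable fun j => ‖a j‖)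
    (h : IsReciprocal v u) (hv : ∀ᵐ θ ∂circProb, v θ ^ 2 = f θ + g θ)
    (hY : Y =ᵐ[circProb] fun θ => wienerFilter f g a θ * v θ) {U : CircleL2 →ₗᵢ[ℂ] Lp ℂ 2 P}
    (hU : ∀ k, U (wex v k) = hξ.toL2 k + hη.toL2 k) :
    optimalEstimate (fun k => hξ.toL2 k + hη.toL2 k) (∑' j : ℕ, a j • hξ.toL2 j) =
      U (Y - dualProj u Y) :=
  optimalEstimate_eq h hU (inner_observation_tsum_toL2 hξ hη hunc ha h hv hY)

lemma norm_tsum_sub_optimalEstimate_sq (hξ : IsStationary P ξ f) (hη : IsStationary P η g)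
    (hunc : ∀ m n, ∫ ω, ξ m ω * conj (η n ω) ∂P = 0) (ha : Summable fun j => ‖a j‖)
    (h : IsReciprocal v u) (hv : ∀ᵐ θ ∂circProb, v θ ^ 2 = f θ + g θ)
    (hY : Y =ᵐ[circProb] fun θ => wienerFilter f g a θ * v θ) {U : CircleL2 →ₗᵢ[ℂ] Lp ℂ 2 P}
    (hU : ∀ k, U (wex v k) = hξ.toL2 k + hη.toL2 k) :
    ‖(∑' j : ℕ, a j • hξ.toL2 j) -
        optimalEstimate (fun k => hξ.toL2 k + hη.toL2 k) (∑' j : ℕ, a j • hξ.toL2 j)‖ ^ 2 =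
      (∫ θ, ‖symbolA a θ‖ ^ 2 * (f θ * g θ / (f θ + g θ)) ∂circProb) + ‖dualProj u Y‖ ^ 2 := by
  rw [norm_sub_optimalEstimate_sq h hU (inner_observation_tsum_toL2 hξ hη hunc ha h hv hY),
    hξ.norm_tsum_toL2_sq ha,
    integral_norm_symbolA_sq_mul_sub h hv hY (integrable_circProb.2 hξ.integrable) ha]

lemma matVec_toeplitz_div_add (ha : Summable fun j => ‖a j‖)
    (hdiv : MemLp (fun θ => f θ / (f θ + g θ)) ∞ circProb) :
    matVec (toeplitz fun θ => f θ / (f θ + g θ)) a =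
      fun k : ℕ => fourierCoef (wienerFilter f g a) k :=
  matVec_toeplitz ha (hdiv.integrable le_top)

lemma memℓp_matVec_toeplitz_div_add (ha : Summable fun j => ‖a j‖)
    (hdiv : MemLp (fun θ => f θ / (f θ + g θ)) ∞ circProb) :
    Memℓp (matVec (toeplitz fun θ => f θ / (f θ + g θ)) a) 2 := by
  rw [matVec_toeplitz_div_add ha hdiv]
  exact memℓp_fourierCoef ((memLp_wienerFilter hdiv ha).mono_exponent le_top)

lemma isInverse_matVec_toeplitz_iff (ha : Summable fun j => ‖a j‖)
    (hdiv : MemLp (fun θ => f θ / (f θ + g θ)) ∞ circProb) (h : IsReciprocal v u)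
    (hv : ∀ᵐ θ ∂circProb, v θ ^ 2 = f θ + g θ)
    (hY : Y =ᵐ[circProb] fun θ => wienerFilter f g a θ * v θ) (c : ℕ → ℂ) (e : ℂ) :
    IsInverse (toeplitz fun θ => (f θ + g θ)⁻¹)
        (matVec (toeplitz fun θ => f θ / (f θ + g θ)) a) c e ↔
      (c = fun j : ℕ => fourierCoef (inverseSeries v u Y) j) ∧
        e = inner ℂ (dualProj u Y) Y := by
  simpa only [matVec_toeplitz_div_add ha hdiv, ← inner_wex_eq_fourierCoef_wienerFilter h hY] using
    isInverse_toeplitz_iff h (h.sq_eq_inv hv) Y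

lemma hasSum_matVec_toeplitz_mul_conj (ha : Summable fun j => ‖a j‖)
    (hdiv : MemLp (fun θ => f θ / (f θ + g θ)) ∞ circProb)
    (hY : Y =ᵐ[circProb] fun θ => wienerFilter f g a θ * v θ) {c : ℕ → ℂ}
    (hsum : IsFourierSum c (inverseSeries v u Y)) (hc : Memℓp c 2) :
    HasSum (fun k => matVec (toeplitz fun θ => f θ / (f θ + g θ)) a k * conj (c k))
      (inner ℂ (dualProj u Y) Y) := by
  rw [inner_dualProj_eq_mean hY, matVec_toeplitz_div_add ha hdiv]
  exact hsum.hasSum_mul_conj hc ((memLp_wienerFilter hdiv ha).mono_exponent le_top)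

lemma mul_sub_div_add (z w : ℂ) {x y : ℂ} (h : x + y ≠ 0) :
    (z * x - w) / (x + y) = z - (z * y + w) / (x + y) := by
  field_simp
  ring

lemma integrable_and_integral_norm_inverseSeries_sq (hf : Integrable f circProb)
    (hg : Integrable g circProb) (hf0 : ∀ᵐ θ ∂circProb, 0 ≤ f θ) (hg0 : ∀ᵐ θ ∂circProb, 0 ≤ g θ)
    (ha : Summable fun j => ‖a j‖) (h : IsReciprocal v u)
    (hv : ∀ᵐ θ ∂circProb, v θ ^ 2 = f θ + g θ) (Y : CircleL2) :
    let C := inverseSeries v u Y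
    Integrable (fun θ => ‖symbolA a θ * g θ + C θ‖ ^ 2 / (f θ + g θ) ^ 2 * f θ) circProb ∧
      Integrable (fun θ => ‖symbolA a θ * f θ - C θ‖ ^ 2 / (f θ + g θ) ^ 2 * g θ) circProb ∧
      (∫ θ, ‖symbolA a θ * g θ + C θ‖ ^ 2 / (f θ + g θ) ^ 2 * f θ ∂circProb) +
          ∫ θ, ‖symbolA a θ * f θ - C θ‖ ^ 2 / (f θ + g θ) ^ 2 * g θ ∂circProb =
        (∫ θ, ‖symbolA a θ‖ ^ 2 * (f θ * g θ / (f θ + g θ)) ∂circProb) + ‖dualProj u Y‖ ^ 2 := by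
  have hA := (continuous_symbolA ha).aestronglyMeasurable (μ := circProb)
  have hC := (integrable_inverseSeries v u Y).1
  have hne := h.add_ne_zero hv
  have hAi := integrable_norm_symbolA_sq_mul ha
    (integrable_mul_div_add hg (memLp_div_add hf.1 hg.1 hf0 hg0))
  have hu := h.sq_eq_inv hv
  have hX := dualProj_ae_eq h Y
  have hCi := integrable_norm_sq_mul_of_ae_eq hu hX
  have hint := integrable_norm_add_sq_and_integrable_norm_sub_sq hA hC hf.1 hg.1 hf0 hg0 hne hAi hCi
  refine ⟨hint.1, hint.2, ?_⟩
  rw [norm_sq_eq_integral_of_ae_eq hu hX]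
  exact integral_norm_add_sq_add_integral_norm_sub_sq hA hC hf.1 hg.1 hf0 hg0 hne hAi hCi

end Main

end Extrapolation

end

open Extrapolation in
theorem theorem2_general {Ω : Type*} [MeasurableSpace Ω] (P : Measure Ω)
    (ξ η : ℤ → Ω → ℂ) (f g : ℝ → ℝ) (a : ℕ → ℂ)
    (hξ : IsStationary P ξ f) (hη : IsStationary P η g)
    (hunc : ∀ m n, ∫ ω, ξ m ω * conj (η n ω) ∂P = 0)
    (hpos : ∀ᵐ θ ∂circ, 0 < f θ + g θ)
    (hmin : Integrable (fun θ => (f θ + g θ)⁻¹) circ)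
    (ha : Summable fun j => ‖a j‖) :
    let w : ℝ → ℝ := fun θ => f θ + g θ
    let B := toeplitz fun θ => (f θ + g θ)⁻¹
    let R := toeplitz fun θ => f θ / (f θ + g θ)
    let Q := toeplitz fun θ => f θ * g θ / (f θ + g θ)
    let A : ℝ → ℂ := symbolA a
    let Ra : ℕ → ℂ := matVec R a
    let ζ : ℤ → Lp ℂ 2 P := fun k => hξ.toL2 k + hη.toL2 k
    let Aξ : Lp ℂ 2 P := ∑' j : ℕ, a j • hξ.toL2 j
    let est : Lp ℂ 2 P := optimalEstimate ζ Aξ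
    Summable (fun j : ℕ => a j • hξ.toL2 j) ∧ Memℓp Ra 2 ∧
    ∃ (c : ℕ → ℂ) (e : ℂ) (C : ℝ → ℂ),
      IsInverse B Ra c e ∧ (∀ c' e', IsInverse B Ra c' e' → c' = c ∧ e' = e) ∧
      IsFourierSum c C ∧ (∀ C', IsFourierSum c C' → C' =ᵐ[circ] C) ∧
      (∀ h : ℝ → ℂ, IsSpectralIntegral ζ w h est ↔
        h =ᵐ[circ] fun θ => (A θ * f θ - C θ) / (f θ + g θ)) ∧
      ((fun θ => (A θ * f θ - C θ) / (f θ + g θ)) =ᵐ[circ]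
        fun θ => A θ - (A θ * g θ + C θ) / (f θ + g θ)) ∧
      MemClosedSpan (Set.Iio 0) w (fun θ => (A θ * f θ - C θ) / (f θ + g θ)) ∧
      Integrable (fun θ => ‖A θ * g θ + C θ‖ ^ 2 / (f θ + g θ) ^ 2 * f θ) circ ∧
      Integrable (fun θ => ‖A θ * f θ - C θ‖ ^ 2 / (f θ + g θ) ^ 2 * g θ) circ ∧
      ‖Aξ - est‖ ^ 2 =
        1 / (2 * Real.pi) * ∫ θ, ‖A θ * g θ + C θ‖ ^ 2 / (f θ + g θ) ^ 2 * f θ ∂circ +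
        1 / (2 * Real.pi) * ∫ θ, ‖A θ * f θ - C θ‖ ^ 2 / (f θ + g θ) ^ 2 * g θ ∂circ ∧
      ((‖Aξ - est‖ ^ 2 : ℝ) : ℂ) = e + pairing (matVec Q a) a ∧
      (∀ T : lp (fun _ : ℕ => ℂ) 2 →L[ℂ] lp (fun _ : ℕ => ℂ) 2,
        (∀ (x : lp (fun _ : ℕ => ℂ) 2) (k : ℕ), HasSum (fun j => B k j * x j) (T x k)) →
        ∀ x : lp (fun _ : ℕ => ℂ) 2, (∀ k, T x k = Ra k) → ∀ j, x j = c j) ∧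
      ((∃ K : ℝ, ∀ᵐ θ ∂circ, f θ + g θ ≤ K) → Memℓp c 2) ∧
      (Memℓp c 2 →
        HasSum (fun k => Ra k * conj (c k)) e ∧
        Tendsto (fun n => sqDist (fun _ => 1) fun θ =>
          C θ - ∑ j ∈ Finset.range n, c j * ex j θ) atTop (𝓝 0)) := by
  intro w B R Q A Ra ζ Aξ est
  have hf := integrable_circProb.2 hξ.integrable
  have hg := integrable_circProb.2 hη.integrable
  have hf0 := hξ.nonneg
  have hg0 := hη.nonneg
  rw [← ae_circProb] at hf0 hg0 hpos
  obtain ⟨v, u, h, hv⟩ := exists_isReciprocal (w := w) (hf.add hg) (integrable_circProb.2 hmin) hpos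
  have hv0 : ∀ᵐ θ ∂circProb, v θ ≠ 0 := h.mono fun θ => left_ne_zero_of_mul_eq_one
  have hne := h.add_ne_zero hv
  have hdiv := memLp_div_add hf.1 hg.1 hf0 hg0
  obtain ⟨Y, hY⟩ := exists_ae_eq_mul_weight (memLp_wienerFilter hdiv ha) v
  obtain ⟨U, hU⟩ := exists_linearIsometry_observations hξ hη hunc hv hv0
  have hinv : ∀ c e, IsInverse B Ra c e ↔ _ := isInverse_matVec_toeplitz_iff ha hdiv h hv hY
  have hsum := isFourierSum_inverseSeries h Y
  have hchar := sub_dualProj_ae_eq h hv hY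
  have hest : est = U (Y - dualProj u Y) := optimalEstimate_tsum_eq hξ hη hunc ha h hv hY hU
  have herr := norm_tsum_sub_optimalEstimate_sq hξ hη hunc ha h hv hY hU
  obtain ⟨hint₁, hint₂, hint⟩ :=
    integrable_and_integral_norm_inverseSeries_sq hf hg hf0 hg0 ha h hv Y
  refine ⟨hξ.summable_smul_toL2 ha, memℓp_matVec_toeplitz_div_add ha hdiv, _, _,
    inverseSeries v u Y, (hinv _ _).2 ⟨rfl, rfl⟩, fun c e => (hinv c e).1, hsum,
    fun C => hsum.ae_eq, fun φ => ?_, ?_, ?_, integrable_circProb.1 hint₁,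
    integrable_circProb.1 hint₂, ?_, ?_, fun T hT x hx j => ?_, fun ⟨K, hK⟩ => ?_, fun hc =>
      ⟨hasSum_matVec_toeplitz_mul_conj ha hdiv hY hsum hc, hsum.tendsto_sqDist hc⟩⟩
  · rw [hest]
    exact isSpectralIntegral_iff_ae_eq hU hv hv0 hchar φ
  · rw [EventuallyEq, ← ae_circProb]
    exact hne.mono fun θ h0 => mul_sub_div_add _ _ (by exact_mod_cast h0)
  · exact memClosedSpan_of_mem_closedSpan hv (aestronglyMeasurable_of_mul_weight hv0 hchar) hchar
      (sub_dualProj_mem_closedSpan h Y)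
  · rw [herr, ← hint, integral_circProb, integral_circProb, smul_eq_mul, smul_eq_mul]
  · rw [herr, pairing_toeplitz ha (integrable_mul_div_add hg hdiv), inner_dualProj_self,
      Complex.ofReal_add, add_comm]
  · rw [((hinv _ _).1 (isInverse_of_bounded T hT hx)).1]
  · rw [← ae_circProb] at hK
    have hvK : ∀ᵐ θ ∂circProb, v θ ^ 2 ≤ K := hv.mp (hK.mono fun θ hKθ hvθ => hvθ.trans_le hKθ)
    exact memℓp_fourierCoef (memLp_inverseSeries hvK Y)

open Extrapolation in
theorem theorem2 {Ω : Type*} [MeasurableSpace Ω] (P : Measure Ω) [IsProbabilityMeasure P]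
    (ξ η : ℤ → Ω → ℂ) (f g : ℝ → ℝ) (a : ℕ → ℂ)
    (hξ : IsStationary P ξ f) (hη : IsStationary P η g)
    (hind : IndepFun (fun ω k => ξ k ω) (fun ω k => η k ω) P)
    (hf : ∀ᵐ θ ∂circ, 0 < f θ) (hg : ∀ᵐ θ ∂circ, 0 < g θ)
    (hmin : Integrable (fun θ => (f θ + g θ)⁻¹) circ)
    (ha : Summable fun j => ‖a j‖)
    (ha' : Summable fun j : ℕ => ((j : ℝ) + 1) * ‖a j‖ ^ 2) :
    let w : ℝ → ℝ := fun θ => f θ + g θ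
    let B := toeplitz fun θ => (f θ + g θ)⁻¹
    let R := toeplitz fun θ => f θ / (f θ + g θ)
    let Q := toeplitz fun θ => f θ * g θ / (f θ + g θ)
    let A : ℝ → ℂ := symbolA a
    let Ra : ℕ → ℂ := matVec R a
    let ζ : ℤ → Lp ℂ 2 P := fun k => hξ.toL2 k + hη.toL2 k
    let Aξ : Lp ℂ 2 P := ∑' j : ℕ, a j • hξ.toL2 j
    let est : Lp ℂ 2 P := optimalEstimate ζ Aξ
    -- the functional is well defined, and `Ra ∈ ℓ₂`
    Summable (fun j : ℕ => a j • hξ.toL2 j) ∧ Memℓp Ra 2 ∧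
    ∃ (c : ℕ → ℂ) (e : ℂ) (C : ℝ → ℂ),
      -- `c = B⁻¹ R a`, `e = ⟨R a, B⁻¹ R a⟩`, `C = ∑ c_j e^{ijθ}`, all well defined
      IsInverse B Ra c e ∧ (∀ c' e', IsInverse B Ra c' e' → c' = c ∧ e' = e) ∧
      IsFourierSum c C ∧ (∀ C', IsFourierSum c C' → C' =ᵐ[circ] C) ∧
      -- the spectral characteristic of the optimal estimate
      (∀ h : ℝ → ℂ, IsSpectralIntegral ζ w h est ↔
        h =ᵐ[circ] fun θ => (A θ * f θ - C θ) / (f θ + g θ)) ∧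
      ((fun θ => (A θ * f θ - C θ) / (f θ + g θ)) =ᵐ[circ]
        fun θ => A θ - (A θ * g θ + C θ) / (f θ + g θ)) ∧
      MemClosedSpan (Set.Iio 0) w (fun θ => (A θ * f θ - C θ) / (f θ + g θ)) ∧
      -- the mean square error
      Integrable (fun θ => ‖A θ * g θ + C θ‖ ^ 2 / (f θ + g θ) ^ 2 * f θ) circ ∧
      Integrable (fun θ => ‖A θ * f θ - C θ‖ ^ 2 / (f θ + g θ) ^ 2 * g θ) circ ∧
      ‖Aξ - est‖ ^ 2 =
        1 / (2 * Real.pi) * ∫ θ, ‖A θ * g θ + C θ‖ ^ 2 / (f θ + g θ) ^ 2 * f θ ∂circ +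
        1 / (2 * Real.pi) * ∫ θ, ‖A θ * f θ - C θ‖ ^ 2 / (f θ + g θ) ^ 2 * g θ ∂circ ∧
      ((‖Aξ - est‖ ^ 2 : ℝ) : ℂ) = e + pairing (matVec Q a) a ∧
      -- agreement with the inverse, the series and the inner product of `ℓ₂`
      (∀ T : lp (fun _ : ℕ => ℂ) 2 →L[ℂ] lp (fun _ : ℕ => ℂ) 2,
        (∀ (x : lp (fun _ : ℕ => ℂ) 2) (k : ℕ), HasSum (fun j => B k j * x j) (T x k)) →
        ∀ x : lp (fun _ : ℕ => ℂ) 2, (∀ k, T x k = Ra k) → ∀ j, x j = c j) ∧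
      ((∃ K : ℝ, ∀ᵐ θ ∂circ, f θ + g θ ≤ K) → Memℓp c 2) ∧
      (Memℓp c 2 →
        HasSum (fun k => Ra k * conj (c k)) e ∧
        Tendsto (fun n => sqDist (fun _ => 1) fun θ =>
          C θ - ∑ j ∈ Finset.range n, c j * ex j θ) atTop (𝓝 0)) :=
  theorem2_general P ξ η f g a hξ hη (integral_mul_conj_eq_zero_of_indepFun hξ hη hind)
    (hf.mp (hg.mono fun _ hgθ hfθ => add_pos hfθ hgθ)) hmin ha
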